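/- Let $n\ge 0$, $t,u,v\in\mathbb C$. Let the signed permutations of $\{1,\dots,n\}$ act on $\mathbb C^n$, permuting the vectors $\pm\mathfrak e_i$ of the standard basis; $s_{ij}$ is the transposition of $i,j$, $\tau_i$ the sign change at $i$, and $\bar s_{ij}=\tau_i\tau_js_{ij}$ ($i\ne j$). Let $W$ be $W_{A_{n-1}}=S_n$, $W_{B_n}$ (all signed permutations) or $W_{D_n}$ (those with an even number of signs). Let $\mathcal C_{2n}$ be the complex Clifford algebra with generators $c_1,\dots,c_n,e_1,\dots,e_n$, which pairwise anticommute and have square $1$. A signed permutation $w$ with $w\mathfrak e_i=\pm\mathfrak e_j$ acts by $c_i^w=\pm c_j$, $e_i^w=\pm e_j$, $x_i^w=\pm x_j$, $y_i^w=\pm y_j$ and, multiplicatively, on $\mathbb C[x_1,\dots,x_n]$. Put $K=\mathcal C_{2n}\rtimes\mathbb CW$. Let $\ddot{\mathbf H}_W$ be the $\mathbb C$-algebra generated by $x_i,y_i$ $(1\le i\le n)$ and $K$ with the relations $x_ix_j=x_jx_i$, $y_iy_j=y_jy_i$, $wx_i=x_i^ww$, $wy_i=y_i^ww$ $(w\in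 W)$, $e_ix_j=x_je_i$, $c_ix_j=(-1)^{\delta_{ij}}x_jc_i$, $c_iy_j=y_jc_i$, $e_iy_j=(-1)^{\delta_{ij}}y_je_i$ (all $i,j$) and, in type $B_n$, with $i\neq j$, $$[y_i,x_j]=u(1+c_ic_j)(1+e_je_i)s_{ij}-u(1-c_ic_j)(1-e_je_i)\bar s_{ij},$$ $$[y_i,x_i]=tc_ie_i-u\sum_{k\ne i}(1+c_kc_i)(1+e_ke_i)s_{ki}-u\sum_{k\ne i}(1-c_kc_i)(1-e_ke_i)\bar s_{ki}-v\tau_i;$$ in type $D_n$ the term with $v$ is omitted, and in type $A_{n-1}$ the terms with $v$ and with $\bar s$ are omitted. Let $\mathfrak H_y$ be the subalgebra of $\ddot{\mathbf H}_W$ generated by $K$ and $y_1,\dots,y_n$. Theorem. Let $M$ be any $K$-module. Then $M$ extends uniquely to an $\mathfrak H_y$-module on which every $y_i$ acts as zero. Let $M_y=\ddot{\mathbf H}_W\otimes_{\mathfrak H_y}M$ be the induced $\ddot{\mathbf H}_W$-module. The map $f\otimes m\mapsto f\cdot(1\otimes m)$ is a linear isomorphism $\mathbb C[x_1,\dots,x_n]\otimes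 M\to M_y$. Under this identification, for $f\in\mathbb C[x_1,\dots,x_n]$ and $m\in M$, $x_i\cdot(f\otimes m)=x_if\otimes m$, $w\cdot(f\otimes m)=f^w\otimes wm$ $(w\in W)$, $c_i\cdot(f\otimes m)=f^{\tau_i}\otimes c_im$, $e_i\cdot(f\otimes m)=f\otimes e_im$, and $y_i$ acts by the following Dunkl operator, where $g\,c_kc_i\otimes m'$ means $g\otimes c_kc_im'$ and the quotients are exact quotients of polynomials. In type $B_n$, $$\begin{aligned}y_i\cdot(f\otimes m)={}&t\,\frac{f-f^{\tau_i}}{2x_i}\otimes c_ie_im-u\sum_{k\ne i}\Big(\frac{f-f^{s_{ki}}}{x_i-x_k}+\frac{f-f^{\bar s_{ki}}}{x_i+x_k}c_kc_i\Big)\otimes(1+e_ke_i)s_{ki}m\\&-u\sum_{k\ne i}\Big(\frac{f-f^{\bar s_{ki}}}{x_i+x_k}-\frac{f-f^{s_{ki}}}{x_i-x_k}c_kc_i\Big)\otimes(1-e_ke_i)\bar s_{ki}m-v\,\frac{f-f^{\tau_i}}{2x_i}\otimes\tau_im.\end{aligned}$$ In type $D_n$ the same formula holds without the term with $v$. In type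 $A_{n-1}$, $$y_i\cdot(f\otimes m)=t\,\frac{f-f^{\tau_i}}{2x_i}\otimes c_ie_im-u\sum_{k\ne i}\Big(\frac{f-f^{s_{ki}}}{x_i-x_k}+\frac{f-(f^{s_{ki}})^{\tau_i\tau_k}}{x_i+x_k}c_kc_i\Big)\otimes(1+e_ke_i)s_{ki}m.$$ -/

import Mathlib

open scoped TensorProduct

namespace DunklDaHa

/-! ### Signed permutations and the classical Weyl groups -/

/-- The group of signed permutations of `1, …, n`: the pair `(ε, σ)` sends the basis vector `𝔢_i`
to `ε (σ i) 𝔢_{σ i}`. -/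
abbrev SignedPerm (n : ℕ) : Type :=
  (Fin n → ℤˣ) ⋊[(mulAutArrow : Equiv.Perm (Fin n) →* MulAut (Fin n → ℤˣ))] Equiv.Perm (Fin n)

variable {n : ℕ}

/-- The underlying permutation of a signed permutation. -/
def perm (w : SignedPerm n) : Equiv.Perm (Fin n) := w.right

/-- The sign `ε` with `w 𝔢_i = ε 𝔢_{perm w i}`. -/
def sgn (w : SignedPerm n) (i : Fin n) : ℂ := ((w.left (w.right i) : ℤ) : ℂ)

/-- The transposition `s_{ij} = (i, j)`. -/
def sRefl (i j : Fin n) : SignedPerm n := SemidirectProduct.inr (Equiv.swap i j)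

/-- The sign change `τ_i` at `i`. -/
def tauRefl (i : Fin n) : SignedPerm n := SemidirectProduct.inl (Pi.mulSingle i (-1))

/-- The transposition of `i` and `j` coupled with the sign changes at `i` and `j`. -/
def sBar (i j : Fin n) : SignedPerm n := tauRefl i * tauRefl j * sRefl i j

/-- The product of all signs of a signed permutation. -/
def signProd (n : ℕ) : SignedPerm n →* ℤˣ :=
  MonoidHom.mk' (fun w => ∏ j, w.left j) (fun a b => by
    simp only [SemidirectProduct.mul_left, Pi.mul_apply, Finset.prod_mul_distrib]
    congr 1
    exact Equiv.prod_comp (a.right⁻¹ : Equiv.Perm (Fin n)) b.left)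

/-- The Weyl group of type `A_{n-1}`: all permutations. -/
def weylA (n : ℕ) : Subgroup (SignedPerm n) := (SemidirectProduct.inr).range

/-- The Weyl group of type `B_n`: all signed permutations. -/
def weylB (n : ℕ) : Subgroup (SignedPerm n) := ⊤

/-- The Weyl group of type `D_n`: all even signed permutations. -/
def weylD (n : ℕ) : Subgroup (SignedPerm n) := (signProd n).ker

theorem sRefl_mem_weylD (i j : Fin n) : sRefl i j ∈ weylD n := by
  simp [weylD, MonoidHom.mem_ker, sRefl, signProd]

theorem signProd_tauRefl (i : Fin n) : signProd n (tauRefl i) = -1 := by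
  simp [tauRefl, signProd]

theorem sBar_mem_weylD (i j : Fin n) : sBar i j ∈ weylD n := by
  have h : signProd n (sRefl i j) = 1 := sRefl_mem_weylD i j
  rw [weylD, MonoidHom.mem_ker, sBar, map_mul, map_mul, signProd_tauRefl, signProd_tauRefl, h]
  simp

/-- `s_{ij}` as an element of the Weyl group of type `A`. -/
def sA (i j : Fin n) : weylA n := ⟨sRefl i j, ⟨_, rfl⟩⟩

/-- `s_{ij}` as an element of the Weyl group of type `B`. -/
def sB (i j : Fin n) : weylB n := ⟨sRefl i j, trivial⟩

/-- `s̄_{ij}` as an element of the Weyl group of type `B`. -/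
def sbB (i j : Fin n) : weylB n := ⟨sBar i j, trivial⟩

/-- `τ_i` as an element of the Weyl group of type `B`. -/
def tauB (i : Fin n) : weylB n := ⟨tauRefl i, trivial⟩

/-- `s_{ij}` as an element of the Weyl group of type `D`. -/
def sD (i j : Fin n) : weylD n := ⟨sRefl i j, sRefl_mem_weylD i j⟩

/-- `s̄_{ij}` as an element of the Weyl group of type `D`. -/
def sbD (i j : Fin n) : weylD n := ⟨sBar i j, sBar_mem_weylD i j⟩

/-! ### The algebra `K = 𝒞_{2n} ⋊ ℂW` -/

/-- Generators of `𝒞_{2n} ⋊ ℂW`: the Clifford generators `c_i`, `e_i` and the elements of `W`. -/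
inductive KGen (W : Subgroup (SignedPerm n)) : Type
  | c (i : Fin n)
  | e (i : Fin n)
  | w (g : W)

/-- Defining relations of `𝒞_{2n} ⋊ ℂW`: the Clifford relations for the `2n` generators
`c_1, …, c_n, e_1, …, e_n`, the multiplication of `W`, and `σ c_i = c_i^σ σ`,
`σ e_i = e_i^σ σ`. -/
inductive KRel (W : Subgroup (SignedPerm n)) :
    FreeAlgebra ℂ (KGen W) → FreeAlgebra ℂ (KGen W) → Prop
  | c_sq (i : Fin n) : KRel W (FreeAlgebra.ι ℂ (KGen.c i) * FreeAlgebra.ι ℂ (KGen.c i)) 1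
  | e_sq (i : Fin n) : KRel W (FreeAlgebra.ι ℂ (KGen.e i) * FreeAlgebra.ι ℂ (KGen.e i)) 1
  | cc (i j : Fin n) (h : i ≠ j) :
      KRel W (FreeAlgebra.ι ℂ (KGen.c i) * FreeAlgebra.ι ℂ (KGen.c j))
        (-(FreeAlgebra.ι ℂ (KGen.c j) * FreeAlgebra.ι ℂ (KGen.c i)))
  | ee (i j : Fin n) (h : i ≠ j) :
      KRel W (FreeAlgebra.ι ℂ (KGen.e i) * FreeAlgebra.ι ℂ (KGen.e j))
        (-(FreeAlgebra.ι ℂ (KGen.e j) * FreeAlgebra.ι ℂ (KGen.e i)))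
  | ce (i j : Fin n) :
      KRel W (FreeAlgebra.ι ℂ (KGen.c i) * FreeAlgebra.ι ℂ (KGen.e j))
        (-(FreeAlgebra.ι ℂ (KGen.e j) * FreeAlgebra.ι ℂ (KGen.c i)))
  | w_one : KRel W (FreeAlgebra.ι ℂ (KGen.w 1)) 1
  | w_mul (g h : W) :
      KRel W (FreeAlgebra.ι ℂ (KGen.w (g * h)))
        (FreeAlgebra.ι ℂ (KGen.w g) * FreeAlgebra.ι ℂ (KGen.w h))
  | wc (g : W) (i : Fin n) :
      KRel W (FreeAlgebra.ι ℂ (KGen.w g) * FreeAlgebra.ι ℂ (KGen.c i))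
        (sgn (g : SignedPerm n) i •
          (FreeAlgebra.ι ℂ (KGen.c (perm (g : SignedPerm n) i)) * FreeAlgebra.ι ℂ (KGen.w g)))
  | we (g : W) (i : Fin n) :
      KRel W (FreeAlgebra.ι ℂ (KGen.w g) * FreeAlgebra.ι ℂ (KGen.e i))
        (sgn (g : SignedPerm n) i •
          (FreeAlgebra.ι ℂ (KGen.e (perm (g : SignedPerm n) i)) * FreeAlgebra.ι ℂ (KGen.w g)))

/-- The algebra `K = 𝒞_{2n} ⋊ ℂW`. -/
def K (W : Subgroup (SignedPerm n)) : Type := RingQuot (KRel W)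

noncomputable instance (W : Subgroup (SignedPerm n)) : Ring (K W) :=
  inferInstanceAs (Ring (RingQuot (KRel W)))

noncomputable instance (W : Subgroup (SignedPerm n)) : Algebra ℂ (K W) :=
  inferInstanceAs (Algebra ℂ (RingQuot (KRel W)))

namespace K

variable {W : Subgroup (SignedPerm n)}

/-- The Clifford generator `c_i` of `K`. -/
noncomputable def c (i : Fin n) : K W :=
  RingQuot.mkAlgHom ℂ (KRel W) (FreeAlgebra.ι ℂ (KGen.c i))

/-- The Clifford generator `e_i` of `K`. -/
noncomputable def e (i : Fin n) : K W :=
  RingQuot.mkAlgHom ℂ (KRel W) (FreeAlgebra.ι ℂ (KGen.e i))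

/-- The group element `g ∈ W` in `K`. -/
noncomputable def w (g : W) : K W :=
  RingQuot.mkAlgHom ℂ (KRel W) (FreeAlgebra.ι ℂ (KGen.w g))

end K

/-! ### The double affine Hecke algebras -/

/-- Generators of the double affine Hecke algebra: `x_i`, `y_i` and the elements of
`K = 𝒞_{2n} ⋊ ℂW`. -/
inductive HGen (W : Subgroup (SignedPerm n)) : Type
  | x (i : Fin n)
  | y (i : Fin n)
  | k (a : K W)

/-- Defining relations of the double affine Hecke algebra whose brackets `[y_i, x_j]` are
the elements `br i j` of `K`. The first three say that the generators in `K` multiply as in `K`. -/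
inductive HRel (W : Subgroup (SignedPerm n)) (br : Fin n → Fin n → K W) :
    FreeAlgebra ℂ (HGen W) → FreeAlgebra ℂ (HGen W) → Prop
  | k_add (a b : K W) :
      HRel W br (FreeAlgebra.ι ℂ (HGen.k (a + b)))
        (FreeAlgebra.ι ℂ (HGen.k a) + FreeAlgebra.ι ℂ (HGen.k b))
  | k_mul (a b : K W) :
      HRel W br (FreeAlgebra.ι ℂ (HGen.k (a * b)))
        (FreeAlgebra.ι ℂ (HGen.k a) * FreeAlgebra.ι ℂ (HGen.k b))
  | k_algebraMap (r : ℂ) :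
      HRel W br (FreeAlgebra.ι ℂ (HGen.k (algebraMap ℂ (K W) r)))
        (algebraMap ℂ (FreeAlgebra ℂ (HGen W)) r)
  | xx (i j : Fin n) :
      HRel W br (FreeAlgebra.ι ℂ (HGen.x i) * FreeAlgebra.ι ℂ (HGen.x j))
        (FreeAlgebra.ι ℂ (HGen.x j) * FreeAlgebra.ι ℂ (HGen.x i))
  | yy (i j : Fin n) :
      HRel W br (FreeAlgebra.ι ℂ (HGen.y i) * FreeAlgebra.ι ℂ (HGen.y j))
        (FreeAlgebra.ι ℂ (HGen.y j) * FreeAlgebra.ι ℂ (HGen.y i))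
  | wx (g : W) (i : Fin n) :
      HRel W br (FreeAlgebra.ι ℂ (HGen.k (K.w g)) * FreeAlgebra.ι ℂ (HGen.x i))
        (sgn (g : SignedPerm n) i •
          (FreeAlgebra.ι ℂ (HGen.x (perm (g : SignedPerm n) i)) *
            FreeAlgebra.ι ℂ (HGen.k (K.w g))))
  | wy (g : W) (i : Fin n) :
      HRel W br (FreeAlgebra.ι ℂ (HGen.k (K.w g)) * FreeAlgebra.ι ℂ (HGen.y i))
        (sgn (g : SignedPerm n) i •
          (FreeAlgebra.ι ℂ (HGen.y (perm (g : SignedPerm n) i)) *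
            FreeAlgebra.ι ℂ (HGen.k (K.w g))))
  | ex (i j : Fin n) :
      HRel W br (FreeAlgebra.ι ℂ (HGen.k (K.e i)) * FreeAlgebra.ι ℂ (HGen.x j))
        (FreeAlgebra.ι ℂ (HGen.x j) * FreeAlgebra.ι ℂ (HGen.k (K.e i)))
  | cx (i j : Fin n) :
      HRel W br (FreeAlgebra.ι ℂ (HGen.k (K.c i)) * FreeAlgebra.ι ℂ (HGen.x j))
        ((if i = j then (-1 : ℂ) else 1) •
          (FreeAlgebra.ι ℂ (HGen.x j) * FreeAlgebra.ι ℂ (HGen.k (K.c i))))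
  | cy (i j : Fin n) :
      HRel W br (FreeAlgebra.ι ℂ (HGen.k (K.c i)) * FreeAlgebra.ι ℂ (HGen.y j))
        (FreeAlgebra.ι ℂ (HGen.y j) * FreeAlgebra.ι ℂ (HGen.k (K.c i)))
  | ey (i j : Fin n) :
      HRel W br (FreeAlgebra.ι ℂ (HGen.k (K.e i)) * FreeAlgebra.ι ℂ (HGen.y j))
        ((if i = j then (-1 : ℂ) else 1) •
          (FreeAlgebra.ι ℂ (HGen.y j) * FreeAlgebra.ι ℂ (HGen.k (K.e i))))
  | yx (i j : Fin n) :
      HRel W br (FreeAlgebra.ι ℂ (HGen.y i) * FreeAlgebra.ι ℂ (HGen.x j) -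
          FreeAlgebra.ι ℂ (HGen.x j) * FreeAlgebra.ι ℂ (HGen.y i))
        (FreeAlgebra.ι ℂ (HGen.k (br i j)))

/-- The algebra generated by `x_i`, `y_i` and `K = 𝒞_{2n} ⋊ ℂW` with `[y_i, x_j] = br i j`. -/
def H (W : Subgroup (SignedPerm n)) (br : Fin n → Fin n → K W) : Type := RingQuot (HRel W br)

noncomputable instance (W : Subgroup (SignedPerm n)) (br : Fin n → Fin n → K W) :
    Ring (H W br) :=
  inferInstanceAs (Ring (RingQuot (HRel W br)))

noncomputable instance (W : Subgroup (SignedPerm n)) (br : Fin n → Fin n → K W) :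
    Algebra ℂ (H W br) :=
  inferInstanceAs (Algebra ℂ (RingQuot (HRel W br)))

/-- The brackets `[y_i, x_j]` of type `A_{n-1}` with parameters `t`, `u`. -/
noncomputable def brA (t u : ℂ) (i j : Fin n) : K (weylA n) :=
  if i = j then
    t • (K.c i * K.e i)
      - u • ∑ k ∈ Finset.univ.erase i, (1 + K.c k * K.c i) * (1 + K.e k * K.e i) * K.w (sA k i)
  else
    u • ((1 + K.c i * K.c j) * (1 + K.e j * K.e i) * K.w (sA i j))

/-- The brackets `[y_i, x_j]` of type `B_n` with parameters `t`, `u`, `v`. -/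
noncomputable def brB (t u v : ℂ) (i j : Fin n) : K (weylB n) :=
  if i = j then
    t • (K.c i * K.e i)
      - u • ∑ k ∈ Finset.univ.erase i, (1 + K.c k * K.c i) * (1 + K.e k * K.e i) * K.w (sB k i)
      - u • ∑ k ∈ Finset.univ.erase i, (1 - K.c k * K.c i) * (1 - K.e k * K.e i) * K.w (sbB k i)
      - v • K.w (tauB i)
  else
    u • ((1 + K.c i * K.c j) * (1 + K.e j * K.e i) * K.w (sB i j))
      - u • ((1 - K.c i * K.c j) * (1 - K.e j * K.e i) * K.w (sbB i j))

/-- The brackets `[y_i, x_j]` of type `D_n` with parameters `t`, `u`. -/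
noncomputable def brD (t u : ℂ) (i j : Fin n) : K (weylD n) :=
  if i = j then
    t • (K.c i * K.e i)
      - u • ∑ k ∈ Finset.univ.erase i, (1 + K.c k * K.c i) * (1 + K.e k * K.e i) * K.w (sD k i)
      - u • ∑ k ∈ Finset.univ.erase i, (1 - K.c k * K.c i) * (1 - K.e k * K.e i) * K.w (sbD k i)
  else
    u • ((1 + K.c i * K.c j) * (1 + K.e j * K.e i) * K.w (sD i j))
      - u • ((1 - K.c i * K.c j) * (1 - K.e j * K.e i) * K.w (sbD i j))

namespace H

variable {W : Subgroup (SignedPerm n)} (br : Fin n → Fin n → K W)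

/-- The generator `x_i`. -/
noncomputable def x (i : Fin n) : H W br :=
  RingQuot.mkAlgHom ℂ (HRel W br) (FreeAlgebra.ι ℂ (HGen.x i))

/-- The generator `y_i`. -/
noncomputable def y (i : Fin n) : H W br :=
  RingQuot.mkAlgHom ℂ (HRel W br) (FreeAlgebra.ι ℂ (HGen.y i))

/-- The image of `a ∈ K`. -/
noncomputable def ofK (a : K W) : H W br :=
  RingQuot.mkAlgHom ℂ (HRel W br) (FreeAlgebra.ι ℂ (HGen.k a))

theorem x_mul_comm (i j : Fin n) : x br i * x br j = x br j * x br i := by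
  have h := RingQuot.mkAlgHom_rel ℂ (HRel.xx (W := W) (br := br) i j)
  rw [map_mul, map_mul] at h
  exact h

open scoped IsMulCommutative in
/-- The algebra homomorphism `f ↦ f(x_1, …, x_n)`, evaluation of polynomials at the pairwise
commuting elements `x_i`. -/
noncomputable def polyX : MvPolynomial (Fin n) ℂ →ₐ[ℂ] H W br :=
  haveI : IsMulCommutative (Algebra.adjoin ℂ (Set.range (x br))) :=
    Algebra.isMulCommutative_adjoin ℂ (by
      rintro _ ⟨i, rfl⟩ _ ⟨j, rfl⟩
      exact x_mul_comm br i j)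
  (Algebra.adjoin ℂ (Set.range (x br))).val.comp
    (MvPolynomial.aeval fun i => ⟨x br i, Algebra.subset_adjoin ⟨i, rfl⟩⟩)

theorem polyX_X (i : Fin n) : polyX br (MvPolynomial.X i) = x br i := by
  simp [polyX]

/-- The subalgebra `ℌ_y` generated by `K` and `y_1, …, y_n`. -/
noncomputable def Hy : Subalgebra ℂ (H W br) :=
  Algebra.adjoin ℂ (Set.range (ofK br) ∪ Set.range (y br))

/-- The image of `a ∈ K`, as an element of `ℌ_y`. -/
noncomputable def hyOfK (a : K W) : Hy br :=
  ⟨ofK br a, Algebra.subset_adjoin (Or.inl ⟨a, rfl⟩)⟩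

/-- The element `y_i` of `ℌ_y`. -/
noncomputable def hyY (i : Fin n) : Hy br :=
  ⟨y br i, Algebra.subset_adjoin (Or.inr ⟨i, rfl⟩)⟩

end H

/-! ### Polynomials and divided differences -/

/-- The algebra automorphism `f ↦ f^w` of `ℂ[x_1, …, x_n]` with `x_i^w = ± x_{w(i)}`. -/
noncomputable def act (w : SignedPerm n) :
    MvPolynomial (Fin n) ℂ →ₐ[ℂ] MvPolynomial (Fin n) ℂ :=
  MvPolynomial.aeval fun i => sgn w i • MvPolynomial.X (perm w i)

open Classical in
/-- The exact quotient `p / d` of polynomials, for `d ∣ p`. -/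
noncomputable def exactDiv (p d : MvPolynomial (Fin n) ℂ) : MvPolynomial (Fin n) ℂ :=
  if h : d ∣ p then h.choose else 0

theorem mul_exactDiv {p d : MvPolynomial (Fin n) ℂ} (h : d ∣ p) : d * exactDiv p d = p := by
  rw [exactDiv, dif_pos h]
  exact h.choose_spec.symm

theorem dvd_sub_act (w : SignedPerm n) (d : MvPolynomial (Fin n) ℂ)
    (h : ∀ j, d ∣ MvPolynomial.X j - act w (MvPolynomial.X j)) (f : MvPolynomial (Fin n) ℂ) :
    d ∣ f - act w f := by
  have key : (Ideal.Quotient.mkₐ ℂ (Ideal.span {d})) =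
      (Ideal.Quotient.mkₐ ℂ (Ideal.span {d})).comp (act w) := by
    apply MvPolynomial.algHom_ext
    intro j
    exact Ideal.Quotient.eq.2 (Ideal.mem_span_singleton.2 (h j))
  exact Ideal.mem_span_singleton.1 (Ideal.Quotient.eq.1 (DFunLike.congr_fun key f))

theorem act_sRefl_X (k i j : Fin n) :
    act (sRefl k i) (MvPolynomial.X j) = MvPolynomial.X (Equiv.swap k i j) := by
  simp [act, sgn, perm, sRefl]

theorem act_tauRefl_X (i j : Fin n) :
    act (tauRefl i) (MvPolynomial.X j) =
      if j = i then -MvPolynomial.X j else MvPolynomial.X j := by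
  by_cases h : j = i
  · subst h
    simp [act, sgn, perm, tauRefl]
  · simp [act, sgn, perm, tauRefl, h]

theorem act_mul (g h : SignedPerm n) : act (g * h) = (act g).comp (act h) := by
  apply MvPolynomial.algHom_ext
  intro j
  have e : (mulAutArrow g.right) h.left (g.right (h.right j)) = h.left (h.right j) := by
    change h.left (g.right⁻¹ • g.right (h.right j)) = h.left (h.right j)
    simp
  simp only [act, sgn, perm, AlgHom.comp_apply, MvPolynomial.aeval_X, map_smul, smul_smul,
    SemidirectProduct.mul_left, SemidirectProduct.mul_right, Pi.mul_apply, Equiv.Perm.mul_apply, e]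
  push_cast
  rw [mul_comm]

theorem act_sBar_X (k i j : Fin n) (hki : k ≠ i) :
    act (sBar k i) (MvPolynomial.X j) =
      if j = i ∨ j = k then -MvPolynomial.X (Equiv.swap k i j)
      else MvPolynomial.X (Equiv.swap k i j) := by
  rw [sBar, act_mul, act_mul, AlgHom.comp_apply, AlgHom.comp_apply, act_sRefl_X, act_tauRefl_X]
  rcases eq_or_ne j i with rfl | hi
  · simp [act_tauRefl_X, hki]
  rcases eq_or_ne j k with rfl | hk
  · simp [act_tauRefl_X, hki.symm]
  · simp [act_tauRefl_X, Equiv.swap_apply_of_ne_of_ne hk hi, hi, hk]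

/-- `x_i - x_k` divides `f - f^{s_{ki}}`. -/
theorem dvd_sub_act_sRefl (k i : Fin n) (f : MvPolynomial (Fin n) ℂ) :
    (MvPolynomial.X i - MvPolynomial.X k) ∣ f - act (sRefl k i) f := by
  refine dvd_sub_act _ _ (fun j => ?_) f
  rw [act_sRefl_X]
  rcases eq_or_ne j i with rfl | hi
  · simp
  rcases eq_or_ne j k with rfl | hk
  · rw [Equiv.swap_apply_left]
    exact ⟨-1, by ring⟩
  · rw [Equiv.swap_apply_of_ne_of_ne hk hi, sub_self]
    exact dvd_zero _

/-- `x_i + x_k` divides `f - f^{s̄_{ki}}`. -/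
theorem dvd_sub_act_sBar (k i : Fin n) (hki : k ≠ i) (f : MvPolynomial (Fin n) ℂ) :
    (MvPolynomial.X i + MvPolynomial.X k) ∣ f - act (sBar k i) f := by
  refine dvd_sub_act _ _ (fun j => ?_) f
  rw [act_sBar_X k i j hki]
  rcases eq_or_ne j i with rfl | hi
  · simp
  rcases eq_or_ne j k with rfl | hk
  · simp [add_comm]
  · simp [Equiv.swap_apply_of_ne_of_ne hk hi, hi, hk]

/-- `2 x_i` divides `f - f^{τ_i}`. -/
theorem dvd_sub_act_tauRefl (i : Fin n) (f : MvPolynomial (Fin n) ℂ) :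
    (2 * MvPolynomial.X i) ∣ f - act (tauRefl i) f := by
  refine dvd_sub_act _ _ (fun j => ?_) f
  rw [act_tauRefl_X]
  by_cases h : j = i
  · subst h
    simp [two_mul]
  · simp [h]

/-! ### Induced modules -/

section Induced

variable {W : Subgroup (SignedPerm n)} (br : Fin n → Fin n → K W)
variable (M : Type*) [AddCommGroup M] [Module ℂ M]

/-- The representation `ρ` of `ℌ_y` on the `K`-module `M` extends the action of `K`,
and every `y_i` acts trivially. -/
structure IsTrivialExtension [Module (K W) M] (ρ : H.Hy br →ₐ[ℂ] Module.End ℂ M) : Prop where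
  ofK_apply : ∀ (a : K W) (m : M), ρ (H.hyOfK br a) m = a • m
  y_apply : ∀ (i : Fin n) (m : M), ρ (H.hyY br i) m = 0

variable {M}

/-- The relations `h b ⊗ m = h ⊗ b m` (`b ∈ ℌ_y`) in `H ⊗_ℂ M`. -/
noncomputable def balancing (ρ : H.Hy br →ₐ[ℂ] Module.End ℂ M) : Submodule (H W br) (H W br ⊗[ℂ] M) :=
  Submodule.span (H W br)
    {z | ∃ (h : H W br) (b : H.Hy br) (m : M), z = (h * (b : H W br)) ⊗ₜ[ℂ] m - h ⊗ₜ[ℂ] ρ b m}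

/-- The induced module `H ⊗_{ℌ_y} M`, a left `H`-module. -/
abbrev Ind (ρ : H.Hy br →ₐ[ℂ] Module.End ℂ M) : Type _ := (H W br ⊗[ℂ] M) ⧸ balancing br ρ

/-- The element `h ⊗ m` of the induced module. -/
noncomputable def indMk (ρ : H.Hy br →ₐ[ℂ] Module.End ℂ M) (h : H W br) (m : M) : Ind br ρ :=
  (balancing br ρ).mkQ (h ⊗ₜ[ℂ] m)

variable (M) in
/-- `M` extends uniquely to an `ℌ_y`-module on which the `y_i` act trivially; the canonical map
`f ⊗ m ↦ f(x) ⊗ m` identifies `ℂ[x_1, …, x_n] ⊗ M` with the induced module; and under this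
identification `x_i` acts by multiplication, `w ∈ W`, `c_i`, `e_i` act by the standard
formulas, and `y_i` acts by `f ⊗ m ↦ D i f m`. -/
def DunklRealization [Module (K W) M]
    (D : Fin n → MvPolynomial (Fin n) ℂ → M → MvPolynomial (Fin n) ℂ ⊗[ℂ] M) : Prop :=
  (∃! ρ : H.Hy br →ₐ[ℂ] Module.End ℂ M, IsTrivialExtension br M ρ) ∧
  ∀ ρ : H.Hy br →ₐ[ℂ] Module.End ℂ M, IsTrivialExtension br M ρ →
    ∃ Φ : MvPolynomial (Fin n) ℂ ⊗[ℂ] M ≃ₗ[ℂ] Ind br ρ,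
      (∀ f m, Φ (f ⊗ₜ m) = indMk br ρ (H.polyX br f) m) ∧
      (∀ i f m, H.x br i • Φ (f ⊗ₜ m) = Φ ((MvPolynomial.X i * f) ⊗ₜ m)) ∧
      (∀ (g : W) f m, H.ofK br (K.w g) • Φ (f ⊗ₜ m) = Φ (act (g : SignedPerm n) f ⊗ₜ (K.w g • m))) ∧
      (∀ i f m, H.ofK br (K.c i) • Φ (f ⊗ₜ m) = Φ (act (tauRefl i) f ⊗ₜ ((K.c i : K W) • m))) ∧
      (∀ i f m, H.ofK br (K.e i) • Φ (f ⊗ₜ m) = Φ (f ⊗ₜ ((K.e i : K W) • m))) ∧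
      (∀ i f m, H.y br i • Φ (f ⊗ₜ m) = Φ (D i f m))

end Induced

end DunklDaHa

/-! The core of the proof is that the Dunkl operators $D_i$, together with multiplication by the
$x_j$ and the stated action of $K$, satisfy the relations of the double affine Hecke algebra on
$\mathbb C[x]\otimes M$. No composite of divided differences is ever computed. A linear map on
$\mathbb C[x]\otimes M$ is determined by its values on $1\otimes M$ and its commutation with the
$x_j$ (`eq_of_comm_mulX`), so every relation is checked on these two data. Each $D_i$ kills
$1\otimes M$ and has $[D_i,x_j]$ equal to the prescribed bracket $b_{ij}\in K$. Hence the relations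
of $D_i$ with $K$ follow from the equivariance of the $b_{ij}$ (`DunklDatum.kEquivariant`), and
$D_iD_j=D_jD_i$ follows from the Jacobi identity $b_{ik}D_j+D_ib_{jk}=b_{jk}D_i+D_jb_{ik}$
(`DunklDatum.comm`), which uses only the relations of the $D_i$ with $K$.

Given the representation `DunklDatum.rep`, the rest is formal. The subspace $1\otimes M$ is stable
under $\mathfrak H_y$, with each $y_i$ acting as zero, which gives the extension of $M$; it is
unique because $K$ and the $y_i$ generate. The canonical map to the induced module is equivariant,
hence onto, and $a\otimes m\mapsto a\cdot(1\otimes m)$ respects the balancing relations and inverts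
it.

The hypotheses collected in `DunklDatum` are linear in brackets and operators, so the $t$, $u$ and
$v$ terms are treated separately. For the $u$ term, $s_{ij}$ and $\bar s_{ij}$ are the cases
$\eta=\pm1$ of one reflection $s^\eta_{ij}$. The factor $1+\eta c_ic_j$ is what $c_i s^\eta=\eta
s^\eta c_j$ requires for the sign rule of the $c_k$ (`K.c_mul_cc_mul_wE`), and similarly for the
$e_k$. Since $c_kc_i$ acts on polynomials by $\tau_k\tau_i$, which turns $s^\eta$ into $s^{-\eta}$,
each reflection contributes the divided differences at both $s_{ki}$ and $\bar s_{ki}$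
(`reflOp_mul_mulX`). -/

namespace DunklDaHa

variable {n : ℕ}

/-! ### Signed permutations -/

/-- The sign `ε` with `w 𝔢_i = ε 𝔢_{perm w i}`, as a unit of `ℤ`. -/
def usgn (w : SignedPerm n) (i : Fin n) : ℤˣ := w.left (w.right i)

/-- A sign as a complex number. -/
def signC (η : ℤˣ) : ℂ := ((η : ℤ) : ℂ)

theorem sgn_eq (w : SignedPerm n) (i : Fin n) : sgn w i = signC (usgn w i) := rfl

@[simp] theorem signC_one : signC 1 = 1 := by simp [signC]

@[simp] theorem signC_neg (η : ℤˣ) : signC (-η) = -signC η := by simp [signC]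

theorem signC_mul (η θ : ℤˣ) : signC (η * θ) = signC η * signC θ := by simp [signC]

@[simp] theorem signC_mul_self (η : ℤˣ) : signC η * signC η = 1 := by
  rw [← signC_mul, Int.units_mul_self, signC_one]

/-- The reflection exchanging `𝔢_i` and `η 𝔢_j`: this is `s_{ij}` for `η = 1` and `s̄_{ij}` for
`η = -1`. -/
def sEta (η : ℤˣ) (i j : Fin n) : SignedPerm n :=
  ⟨Pi.mulSingle i η * Pi.mulSingle j η, Equiv.swap i j⟩

theorem sEta_comm (η : ℤˣ) (i j : Fin n) : sEta η i j = sEta η j i := by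
  simp [sEta, mul_comm, Equiv.swap_comm]

theorem sEta_one (i j : Fin n) : sEta 1 i j = sRefl i j := by
  ext <;> simp [sEta, sRefl]

/-- The source of the mixed terms in the Dunkl operators: on polynomials $c_ic_j$ acts by
$\tau_i\tau_j$, so in front of $s^\eta$ it produces $s^{-\eta}$. -/
theorem tauRefl_mul_tauRefl_mul_sEta (η : ℤˣ) (i j : Fin n) :
    tauRefl i * (tauRefl j * sEta η i j) = sEta (-η) i j := by
  ext p
  · have h : ∀ a b : ℤˣ, ∀ q : Fin n,
        (Pi.mulSingle q (a * b) : Fin n → ℤˣ) = Pi.mulSingle q a * Pi.mulSingle q b :=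
      fun a b q => Pi.mulSingle_mul (f := fun _ => ℤˣ) q a b
    rw [← neg_one_mul η]
    simp only [sEta, h, tauRefl, SemidirectProduct.mul_left, SemidirectProduct.left_inl,
      SemidirectProduct.right_inl, map_one, MulAut.one_apply, Pi.mul_apply]
    push_cast
    ring
  · simp [sEta, tauRefl]

theorem sEta_neg_one (i j : Fin n) : sEta (-1) i j = sBar i j := by
  rw [← tauRefl_mul_tauRefl_mul_sEta, sEta_one, sBar, mul_assoc]

theorem perm_sEta (η : ℤˣ) (i j : Fin n) : perm (sEta η i j) = Equiv.swap i j := rfl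

theorem usgn_sEta_left (η : ℤˣ) {i j : Fin n} (h : i ≠ j) : usgn (sEta η i j) i = η := by
  simp [usgn, sEta, h]

theorem usgn_sEta_right (η : ℤˣ) {i j : Fin n} (h : i ≠ j) : usgn (sEta η i j) j = η := by
  simp [usgn, sEta, h]

theorem usgn_sEta_of_ne (η : ℤˣ) {i j k : Fin n} (hi : k ≠ i) (hj : k ≠ j) :
    usgn (sEta η i j) k = 1 := by
  simp [usgn, sEta, hi, hj, Equiv.swap_apply_of_ne_of_ne]

theorem perm_tauRefl (i j : Fin n) : perm (tauRefl i) j = j := rfl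

theorem usgn_tauRefl (i j : Fin n) : usgn (tauRefl i) j = if j = i then -1 else 1 := by
  by_cases h : j = i
  · subst h; simp [usgn, tauRefl]
  · simp [usgn, tauRefl, h]

theorem mul_left_perm (g h : SignedPerm n) (q : Fin n) :
    (g * h).left (g.right q) = g.left (g.right q) * h.left q := by
  rw [SemidirectProduct.mul_left, Pi.mul_apply]
  congr 1
  change h.left (g.right⁻¹ • g.right q) = _
  simp

theorem mul_tauRefl (g : SignedPerm n) (i : Fin n) :
    g * tauRefl i = tauRefl (perm g i) * g := by
  have h : (g * tauRefl i).left = (tauRefl (perm g i) * g).left := by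
    funext p
    obtain ⟨q, rfl⟩ := g.right.surjective p
    rw [mul_left_perm]
    have := mul_left_perm (tauRefl (perm g i)) g (g.right q)
    simp only [tauRefl, perm, SemidirectProduct.right_inl, Equiv.Perm.coe_one, id_eq,
      SemidirectProduct.left_inl] at this ⊢
    rw [this, mul_comm]
    congr 1
    by_cases hq : q = i
    · subst hq; simp
    · simp [hq]
  refine SemidirectProduct.ext h ?_
  simp [tauRefl]

/-- Conjugation carries the reflection exchanging $\mathfrak e_i$ and $\eta\mathfrak e_j$ to the one
exchanging their images; the two signs of $g$ combine with $\eta$. In particular it may interchange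
$s$ and $\bar s$. -/
theorem mul_sEta (g : SignedPerm n) (η : ℤˣ) {i j : Fin n} (hij : i ≠ j) :
    g * sEta η i j = sEta (η * (usgn g i * usgn g j)) (perm g i) (perm g j) * g := by
  refine SemidirectProduct.ext ?_ (Equiv.mul_swap_eq_swap_mul _ _ _)
  funext p
  have hg : perm g i ≠ perm g j := fun h => hij ((perm g).injective h)
  obtain ⟨q, rfl⟩ := g.right.surjective p
  obtain ⟨r, rfl⟩ := (Equiv.swap i j).surjective q
  -- Each point is written as the image of $r$ under both products, so that `mul_left_perm`
  -- evaluates the signs on both sides without inverses.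
  have e : g.right (Equiv.swap i j r) =
      (sEta (η * (usgn g i * usgn g j)) (perm g i) (perm g j)).right (g.right r) := by
    change (g.right * Equiv.swap i j) r = (Equiv.swap (g.right i) (g.right j) * g.right) r
    rw [Equiv.mul_swap_eq_swap_mul]
  rw [mul_left_perm, e, mul_left_perm, ← e]
  have hu : ∀ k, g.left (g.right k) = usgn g k := fun _ => rfl
  have h2 : ∀ a : ℤˣ, a * a = 1 := Int.units_mul_self
  have hg' : g.right i ≠ g.right j := hg
  rcases eq_or_ne r i with rfl | hi
  · simp only [Equiv.swap_apply_left, hu]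
    simp only [sEta, perm, Pi.mul_apply, Pi.mulSingle_eq_same,
      Pi.mulSingle_eq_of_ne hij.symm, Pi.mulSingle_eq_of_ne hg'.symm, one_mul]
    calc usgn g j * η = η * usgn g j * 1 := by rw [mul_comm, mul_one]
      _ = _ := by rw [← h2 (usgn g r)]; simp only [mul_comm, mul_left_comm]
  rcases eq_or_ne r j with rfl | hj
  · simp only [Equiv.swap_apply_right, hu]
    simp only [sEta, perm, Pi.mul_apply, Pi.mulSingle_eq_same,
      Pi.mulSingle_eq_of_ne hij, Pi.mulSingle_eq_of_ne hg', mul_one]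
    calc usgn g i * η = η * usgn g i * 1 := by rw [mul_comm, mul_one]
      _ = _ := by rw [← h2 (usgn g r)]; simp only [mul_comm, mul_left_comm]
  · rw [Equiv.swap_apply_of_ne_of_ne hi hj, hu]
    have hi' : g.right r ≠ g.right i := fun h => hi (g.right.injective h)
    have hj' : g.right r ≠ g.right j := fun h => hj (g.right.injective h)
    simp [sEta, perm, hi, hj]

theorem tauRefl_mul_self (i : Fin n) : tauRefl i * tauRefl i = 1 := by
  rw [tauRefl, ← map_mul, ← Pi.mulSingle_mul]
  simp

theorem tauRefl_comm (i j : Fin n) : tauRefl i * tauRefl j = tauRefl j * tauRefl i := by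
  rw [tauRefl, tauRefl, ← map_mul, mul_comm, map_mul]

/-! ### Relations in `K` -/

namespace K

variable {W : Subgroup (SignedPerm n)}

theorem c_mul_self (i : Fin n) : (c i * c i : K W) = 1 := by
  have h := RingQuot.mkAlgHom_rel ℂ (KRel.c_sq (W := W) i)
  rwa [map_mul, map_one] at h

theorem e_mul_self (i : Fin n) : (e i * e i : K W) = 1 := by
  have h := RingQuot.mkAlgHom_rel ℂ (KRel.e_sq (W := W) i)
  rwa [map_mul, map_one] at h

theorem c_mul_c {i j : Fin n} (hij : i ≠ j) : (c i * c j : K W) = -(c j * c i) := by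
  have h := RingQuot.mkAlgHom_rel ℂ (KRel.cc (W := W) i j hij)
  rwa [map_neg, map_mul, map_mul] at h

theorem e_mul_e {i j : Fin n} (hij : i ≠ j) : (e i * e j : K W) = -(e j * e i) := by
  have h := RingQuot.mkAlgHom_rel ℂ (KRel.ee (W := W) i j hij)
  rwa [map_neg, map_mul, map_mul] at h

theorem c_mul_e (i j : Fin n) : (c i * e j : K W) = -(e j * c i) := by
  have h := RingQuot.mkAlgHom_rel ℂ (KRel.ce (W := W) i j)
  rwa [map_neg, map_mul, map_mul] at h

theorem w_one : (w 1 : K W) = 1 := by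
  have h := RingQuot.mkAlgHom_rel ℂ (KRel.w_one (W := W))
  rwa [map_one] at h

theorem w_mul (g h : W) : (w (g * h) : K W) = w g * w h := by
  have h := RingQuot.mkAlgHom_rel ℂ (KRel.w_mul (W := W) g h)
  rwa [map_mul] at h

theorem w_mul_c (g : W) (i : Fin n) :
    w g * c i = signC (usgn (g : SignedPerm n) i) • (c (perm (g : SignedPerm n) i) * w g) := by
  have h := RingQuot.mkAlgHom_rel ℂ (KRel.wc (W := W) g i)
  rwa [map_smul, map_mul, map_mul] at h

theorem w_mul_e (g : W) (i : Fin n) :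
    w g * e i = signC (usgn (g : SignedPerm n) i) • (e (perm (g : SignedPerm n) i) * w g) := by
  have h := RingQuot.mkAlgHom_rel ℂ (KRel.we (W := W) g i)
  rwa [map_smul, map_mul, map_mul] at h

open Classical in
/-- The group element `g` in `K` if `g ∈ W`, and `0` otherwise. -/
noncomputable def wE (W : Subgroup (SignedPerm n)) (g : SignedPerm n) : K W :=
  if h : g ∈ W then w ⟨g, h⟩ else 0

theorem wE_coe (g : W) : wE W (g : SignedPerm n) = w g := by
  simp [wE]

/-- The relation is linear in the group element, so it survives the extension by zero outside $W$;
only products of group elements need membership. -/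
theorem wE_mul_c (g : SignedPerm n) (i : Fin n) :
    wE W g * c i = signC (usgn g i) • (c (perm g i) * wE W g) := by
  by_cases h : g ∈ W
  · simpa only [wE, dif_pos h] using w_mul_c ⟨g, h⟩ i
  · simp [wE, h]

theorem wE_mul_e (g : SignedPerm n) (i : Fin n) :
    wE W g * e i = signC (usgn g i) • (e (perm g i) * wE W g) := by
  by_cases h : g ∈ W
  · simpa only [wE, dif_pos h] using w_mul_e ⟨g, h⟩ i
  · simp [wE, h]

theorem wE_mul {g h : SignedPerm n} (hg : g ∈ W) (hh : h ∈ W) :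
    wE W (g * h) = wE W g * wE W h := by
  have := w_mul (⟨g, hg⟩ : W) ⟨h, hh⟩
  rw [wE, wE, wE, dif_pos hg, dif_pos hh, dif_pos (mul_mem hg hh)]
  exact this

theorem wE_tauRefl_mul_c (i j : Fin n) : wE W (tauRefl i) * c j =
    (if j = i then (-1 : ℂ) else 1) • (c j * wE W (tauRefl i)) := by
  rw [wE_mul_c, usgn_tauRefl, perm_tauRefl]
  split_ifs <;> simp

theorem wE_tauRefl_mul_e (i j : Fin n) : wE W (tauRefl i) * e j =
    (if j = i then (-1 : ℂ) else 1) • (e j * wE W (tauRefl i)) := by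
  rw [wE_mul_e, usgn_tauRefl, perm_tauRefl]
  split_ifs <;> simp

/-! ### The Clifford factors of the brackets -/

/-- `1 + η c_i c_j`. -/
noncomputable def cc (W : Subgroup (SignedPerm n)) (η : ℤˣ) (i j : Fin n) : K W :=
  1 + signC η • (c i * c j)

/-- `1 + η e_i e_j`. -/
noncomputable def ee (W : Subgroup (SignedPerm n)) (η : ℤˣ) (i j : Fin n) : K W :=
  1 + signC η • (e i * e j)

/-- Passing the two factors $e_i$, $e_j$ costs two signs, which cancel. -/
theorem commute_c_ee (η : ℤˣ) (k i j : Fin n) : Commute (c k) (ee W η i j) := by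
  refine (Commute.one_right _).add_right (Commute.smul_right ?_ _)
  rw [commute_iff_eq, ← mul_assoc, c_mul_e, neg_mul, mul_assoc, c_mul_e, mul_neg, neg_neg,
    mul_assoc]

theorem commute_e_cc (η : ℤˣ) (k i j : Fin n) : Commute (e k) (cc W η i j) := by
  refine (Commute.one_right _).add_right (Commute.smul_right ?_ _)
  rw [commute_iff_eq, mul_assoc, c_mul_e, mul_neg, ← mul_assoc, ← mul_assoc, c_mul_e, neg_mul,
    neg_neg]

theorem commute_cc_ee (η : ℤˣ) (i j k l : Fin n) : Commute (cc W η i j) (ee W η k l) :=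
  (Commute.one_left _).add_left (((commute_c_ee η i k l).mul_left
    (commute_c_ee η j k l)).smul_left _)

theorem wE_mul_cc (η : ℤˣ) (g : SignedPerm n) (i j : Fin n) :
    wE W g * cc W η i j = cc W (η * (usgn g i * usgn g j)) (perm g i) (perm g j) * wE W g := by
  simp only [cc, mul_add, add_mul, mul_one, one_mul, mul_smul_comm, smul_mul_assoc, signC_mul]
  rw [← mul_assoc, wE_mul_c, smul_mul_assoc, mul_assoc, wE_mul_c, mul_smul_comm, smul_smul,
    smul_smul, mul_assoc, mul_assoc]

theorem wE_mul_ee (η : ℤˣ) (g : SignedPerm n) (i j : Fin n) :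
    wE W g * ee W η i j = ee W (η * (usgn g i * usgn g j)) (perm g i) (perm g j) * wE W g := by
  simp only [ee, mul_add, add_mul, mul_one, one_mul, mul_smul_comm, smul_mul_assoc, signC_mul]
  rw [← mul_assoc, wE_mul_e, smul_mul_assoc, mul_assoc, wE_mul_e, mul_smul_comm, smul_smul,
    smul_smul, mul_assoc, mul_assoc]

/-- Since $s^\eta c_i=\eta c_js^\eta$, the case $k=i$ is $c_i(1+\eta c_ic_j)=c_i+\eta c_j=(1+\eta
c_ic_j)\eta c_j$. For $k=j$ the same computation gives $c_j-\eta c_i=-(1+\eta c_ic_j)\eta c_i$, so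
the sign sits at the second index only. -/
theorem c_mul_cc_mul_wE (η : ℤˣ) {i j : Fin n} (hij : i ≠ j) (k : Fin n) :
    c k * (cc W η i j * wE W (sEta η i j)) =
      (if k = j then (-1 : ℂ) else 1) • (cc W η i j * wE W (sEta η i j) * c k) := by
  rw [mul_assoc _ _ (c k), wE_mul_c, perm_sEta, ← mul_assoc, mul_smul_comm, ← mul_assoc,
    ← smul_mul_assoc, ← smul_mul_assoc]
  congr 1
  rcases eq_or_ne k i with rfl | hi
  · rw [usgn_sEta_left η hij, Equiv.swap_apply_left, if_neg hij, one_smul]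
    simp only [cc, mul_add, add_mul, mul_one, one_mul, mul_smul_comm, smul_mul_assoc, smul_add,
      smul_smul, signC_mul_self, one_smul]
    rw [← mul_assoc, c_mul_self, mul_assoc, c_mul_self, mul_one, one_mul, add_comm]
  rcases eq_or_ne k j with rfl | hj
  · rw [usgn_sEta_right η hij, Equiv.swap_apply_right, if_pos rfl]
    simp only [cc, mul_add, add_mul, mul_one, one_mul, mul_smul_comm, smul_mul_assoc, smul_add,
      smul_smul, signC_mul_self, one_smul]
    rw [c_mul_c hij, mul_neg, ← mul_assoc, c_mul_self, one_mul,
      neg_mul (c _ * c _), mul_assoc, c_mul_self, mul_one]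
    module
  · rw [usgn_sEta_of_ne η hi hj, Equiv.swap_apply_of_ne_of_ne hi hj, if_neg hj, one_smul,
      signC_one, one_smul]
    simp only [cc, mul_add, add_mul, mul_one, one_mul, mul_smul_comm, smul_mul_assoc]
    rw [mul_assoc, c_mul_c hj.symm, mul_neg, ← mul_assoc, ← mul_assoc, c_mul_c hi.symm, neg_mul,
      neg_neg]

theorem e_mul_ee_mul_wE (η : ℤˣ) {i j : Fin n} (hij : i ≠ j) (k : Fin n) :
    e k * (ee W η i j * wE W (sEta η i j)) =
      (if k = j then (-1 : ℂ) else 1) • (ee W η i j * wE W (sEta η i j) * e k) := by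
  rw [mul_assoc _ _ (e k), wE_mul_e, perm_sEta, ← mul_assoc, mul_smul_comm, ← mul_assoc,
    ← smul_mul_assoc, ← smul_mul_assoc]
  congr 1
  rcases eq_or_ne k i with rfl | hi
  · rw [usgn_sEta_left η hij, Equiv.swap_apply_left, if_neg hij, one_smul]
    simp only [ee, mul_add, add_mul, mul_one, one_mul, mul_smul_comm, smul_mul_assoc, smul_add,
      smul_smul, signC_mul_self, one_smul]
    rw [← mul_assoc, e_mul_self, mul_assoc, e_mul_self, mul_one, one_mul, add_comm]
  rcases eq_or_ne k j with rfl | hj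
  · rw [usgn_sEta_right η hij, Equiv.swap_apply_right, if_pos rfl]
    simp only [ee, mul_add, add_mul, mul_one, one_mul, mul_smul_comm, smul_mul_assoc, smul_add,
      smul_smul, signC_mul_self, one_smul]
    rw [e_mul_e hij, mul_neg, ← mul_assoc, e_mul_self, one_mul,
      neg_mul (e _ * e _), mul_assoc, e_mul_self, mul_one]
    module
  · rw [usgn_sEta_of_ne η hi hj, Equiv.swap_apply_of_ne_of_ne hi hj, if_neg hj, one_smul,
      signC_one, one_smul]
    simp only [ee, mul_add, add_mul, mul_one, one_mul, mul_smul_comm, smul_mul_assoc]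
    rw [mul_assoc, e_mul_e hj.symm, mul_neg, ← mul_assoc, ← mul_assoc, e_mul_e hi.symm, neg_mul,
      neg_neg]

end K

/-! ### Relations and induction principles -/

@[elab_as_elim]
theorem K.induction {W : Subgroup (SignedPerm n)} {p : K W → Prop}
    (algebraMap : ∀ r : ℂ, p (algebraMap ℂ (K W) r)) (c : ∀ i, p (K.c i)) (e : ∀ i, p (K.e i))
    (w : ∀ g, p (K.w g)) (add : ∀ a b, p a → p b → p (a + b))
    (mul : ∀ a b, p a → p b → p (a * b)) (a : K W) : p a := by
  obtain ⟨a, rfl⟩ := RingQuot.mkAlgHom_surjective ℂ (KRel W) a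
  induction a using FreeAlgebra.induction with
  | grade0 r =>
    rw [AlgHom.commutes]
    exact algebraMap r
  | grade1 a =>
    cases a with
    | c i => exact c i
    | e i => exact e i
    | w g => exact w g
  | mul a b ha hb =>
    rw [map_mul]
    exact mul _ _ ha hb
  | add a b ha hb =>
    rw [map_add]
    exact add _ _ ha hb

namespace H

variable {W : Subgroup (SignedPerm n)} (br : Fin n → Fin n → K W)

@[elab_as_elim]
theorem induction {p : H W br → Prop}
    (algebraMap : ∀ r : ℂ, p (algebraMap ℂ (H W br) r)) (x : ∀ i, p (x br i))
    (y : ∀ i, p (y br i)) (k : ∀ a, p (ofK br a)) (add : ∀ a b, p a → p b → p (a + b))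
    (mul : ∀ a b, p a → p b → p (a * b)) (a : H W br) : p a := by
  obtain ⟨a, rfl⟩ := RingQuot.mkAlgHom_surjective ℂ (HRel W br) a
  induction a using FreeAlgebra.induction with
  | grade0 r =>
    rw [AlgHom.commutes]
    exact algebraMap r
  | grade1 a =>
    cases a with
    | x i => exact x i
    | y i => exact y i
    | k a => exact k a
  | mul a b ha hb =>
    rw [map_mul]
    exact mul _ _ ha hb
  | add a b ha hb =>
    rw [map_add]
    exact add _ _ ha hb

theorem ofK_add (a b : K W) : ofK br (a + b) = ofK br a + ofK br b := by
  have h := RingQuot.mkAlgHom_rel ℂ (HRel.k_add (W := W) (br := br) a b)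
  rwa [map_add] at h

theorem ofK_mul (a b : K W) : ofK br (a * b) = ofK br a * ofK br b := by
  have h := RingQuot.mkAlgHom_rel ℂ (HRel.k_mul (W := W) (br := br) a b)
  rwa [map_mul] at h

theorem ofK_algebraMap (r : ℂ) : ofK br (algebraMap ℂ (K W) r) = algebraMap ℂ (H W br) r := by
  have h := RingQuot.mkAlgHom_rel ℂ (HRel.k_algebraMap (W := W) (br := br) r)
  rwa [AlgHom.commutes] at h

theorem ofK_w_mul_x (g : W) (i : Fin n) : ofK br (K.w g) * x br i =
    sgn (g : SignedPerm n) i • (x br (perm (g : SignedPerm n) i) * ofK br (K.w g)) := by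
  have h := RingQuot.mkAlgHom_rel ℂ (HRel.wx (W := W) (br := br) g i)
  rwa [map_smul, map_mul, map_mul] at h

theorem ofK_e_mul_x (i j : Fin n) :
    ofK br (K.e i) * x br j = x br j * ofK br (K.e i) := by
  have h := RingQuot.mkAlgHom_rel ℂ (HRel.ex (W := W) (br := br) i j)
  rwa [map_mul, map_mul] at h

theorem ofK_c_mul_x (i j : Fin n) : ofK br (K.c i) * x br j =
    (if i = j then (-1 : ℂ) else 1) • (x br j * ofK br (K.c i)) := by
  have h := RingQuot.mkAlgHom_rel ℂ (HRel.cx (W := W) (br := br) i j)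
  rwa [map_smul, map_mul, map_mul] at h

theorem y_mul_x (i j : Fin n) : y br i * x br j = x br j * y br i + ofK br (br i j) := by
  have h := RingQuot.mkAlgHom_rel ℂ (HRel.yx (W := W) (br := br) i j)
  rw [map_sub, map_mul, map_mul] at h
  exact eq_add_of_sub_eq' h

/-- Elements that permute the `x_j` like a signed permutation do so for all polynomials. -/
theorem mul_polyX (a : H W br) (g : SignedPerm n)
    (h : ∀ j, a * x br j = sgn g j • (x br (perm g j) * a)) (f : MvPolynomial (Fin n) ℂ) :
    a * polyX br f = polyX br (act g f) * a := by
  induction f using MvPolynomial.induction_on with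
  | C r =>
    rw [← MvPolynomial.algebraMap_eq, AlgHom.commutes, AlgHom.commutes, AlgHom.commutes]
    exact (Algebra.commutes r a).symm
  | add p q hp hq => rw [map_add, map_add, map_add, mul_add, add_mul, hp, hq]
  | mul_X p j hp =>
    have e : act g (MvPolynomial.X j) = sgn g j • MvPolynomial.X (perm g j) := by simp [act]
    rw [map_mul, map_mul, map_mul, ← mul_assoc, hp, mul_assoc, mul_assoc, polyX_X, h, e, map_smul,
      polyX_X, smul_mul_assoc]

end H

/-! ### The representation of `K` on `ℂ[x_1, …, x_n] ⊗ M` -/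

theorem act_one : act (1 : SignedPerm n) = AlgHom.id ℂ _ := by
  apply MvPolynomial.algHom_ext
  intro j
  simp [act, sgn, perm]

/-- The action of signed permutations on polynomials as a representation. -/
noncomputable def actEnd : SignedPerm n →* Module.End ℂ (MvPolynomial (Fin n) ℂ) where
  toFun g := (act g).toLinearMap
  map_one' := by rw [act_one]; rfl
  map_mul' g h := by rw [act_mul]; rfl

section Rep

variable {W : Subgroup (SignedPerm n)} (M : Type*) [AddCommGroup M] [Module ℂ M]

/-- The space `ℂ[x_1, …, x_n] ⊗ M`. -/
abbrev PolyTensor (n : ℕ) (M : Type*) [AddCommGroup M] [Module ℂ M] : Type _ :=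
  MvPolynomial (Fin n) ℂ ⊗[ℂ] M

/-- Multiplication by `x_j`. -/
noncomputable def mulX (j : Fin n) : Module.End ℂ (PolyTensor n M) :=
  TensorProduct.map (LinearMap.mulLeft ℂ (MvPolynomial.X j)) LinearMap.id

@[simp] theorem mulX_tmul (j : Fin n) (f : MvPolynomial (Fin n) ℂ) (m : M) :
    mulX M j (f ⊗ₜ m) = (MvPolynomial.X j * f) ⊗ₜ m := rfl

variable {M} in
/-- Two linear maps on `ℂ[x_1, …, x_n] ⊗ M` that agree on `1 ⊗ M` and have the same commutation
relations with the `x_j` agree. -/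
theorem eq_of_comm_mulX {U : Type*} [AddCommGroup U] [Module ℂ U] {A B : PolyTensor n M →ₗ[ℂ] U}
    (T : Fin n → U →ₗ[ℂ] U) (C : Fin n → PolyTensor n M → U)
    (h1 : ∀ m, A (1 ⊗ₜ m) = B (1 ⊗ₜ m)) (hA : ∀ j v, A (mulX M j v) = T j (A v) + C j v)
    (hB : ∀ j v, B (mulX M j v) = T j (B v) + C j v) : A = B := by
  refine TensorProduct.ext' fun f m => ?_
  induction f using MvPolynomial.induction_on with
  | C r =>
    rw [← mul_one (MvPolynomial.C r), ← MvPolynomial.smul_eq_C_mul, ← TensorProduct.smul_tmul',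
      map_smul, map_smul, h1]
  | add p q hp hq => rw [TensorProduct.add_tmul, map_add, map_add, hp, hq]
  | mul_X p j hp => rw [mul_comm, ← mulX_tmul, hA, hB, hp]

-- The form used for products of operators: the remainder in the commutation with $x_j$ is itself an
-- operator.
variable {M} in
theorem eq_of_mul_mulX {A B : Module.End ℂ (PolyTensor n M)}
    (T C : Fin n → Module.End ℂ (PolyTensor n M)) (h1 : ∀ m, A (1 ⊗ₜ m) = B (1 ⊗ₜ m))
    (hA : ∀ j, A * mulX M j = T j * A + C j) (hB : ∀ j, B * mulX M j = T j * B + C j) : A = B :=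
  eq_of_comm_mulX T (fun j => C j) h1 (fun j v => LinearMap.congr_fun (hA j) v)
    (fun j v => LinearMap.congr_fun (hB j) v)

theorem mulX_comm (i j : Fin n) : mulX M i * mulX M j = mulX M j * mulX M i := by
  refine TensorProduct.ext' fun f m => ?_
  simp only [Module.End.mul_apply, mulX_tmul, mul_left_comm]

variable [Module (K W) M] [IsScalarTower ℂ (K W) M]

variable (W) in
/-- The operator `act g ⊗ a`. -/
noncomputable def actTensor (g : SignedPerm n) (a : K W) : Module.End ℂ (PolyTensor n M) :=
  TensorProduct.map (actEnd g) (Algebra.lsmul ℂ ℂ M a)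

@[simp] theorem actTensor_tmul (g : SignedPerm n) (a : K W) (f : MvPolynomial (Fin n) ℂ) (m : M) :
    actTensor W M g a (f ⊗ₜ m) = act g f ⊗ₜ (a • m) := rfl

theorem actTensor_mul (g h : SignedPerm n) (a b : K W) :
    actTensor W M g a * actTensor W M h b = actTensor W M (g * h) (a * b) := by
  rw [actTensor, actTensor, actTensor, map_mul, map_mul, TensorProduct.map_mul]

theorem actTensor_one : actTensor W M 1 1 = 1 := by
  rw [actTensor, map_one, map_one, TensorProduct.map_one]

theorem actTensor_neg (g : SignedPerm n) (a : K W) :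
    actTensor W M g (-a) = -actTensor W M g a := by
  refine TensorProduct.ext' fun f m => ?_
  simp [TensorProduct.tmul_neg]

theorem actTensor_smul (g : SignedPerm n) (r : ℂ) (a : K W) :
    actTensor W M g (r • a) = r • actTensor W M g a := by
  refine TensorProduct.ext' fun f m => ?_
  simp [TensorProduct.tmul_smul]

theorem actTensor_mul_mulX (g : SignedPerm n) (a : K W) (j : Fin n) :
    actTensor W M g a * mulX M j = sgn g j • (mulX M (perm g j) * actTensor W M g a) := by
  refine TensorProduct.ext' fun f m => ?_
  have e : act g (MvPolynomial.X j) = sgn g j • MvPolynomial.X (perm g j) := by simp [act]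
  simp only [Module.End.mul_apply, mulX_tmul, actTensor_tmul, LinearMap.smul_apply, map_mul, e,
    smul_mul_assoc, TensorProduct.smul_tmul']

/-- The operators by which the generators of `K` act on `ℂ[x_1, …, x_n] ⊗ M`. -/
noncomputable def kGenOp : KGen W → Module.End ℂ (PolyTensor n M)
  | KGen.c i => actTensor W M (tauRefl i) (K.c i)
  | KGen.e i => actTensor W M 1 (K.e i)
  | KGen.w g => actTensor W M g (K.w g)

/-- The representation of `K` on `ℂ[x_1, …, x_n] ⊗ M`. -/
noncomputable def kRep : K W →ₐ[ℂ] Module.End ℂ (PolyTensor n M) :=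
  RingQuot.liftAlgHom ℂ ⟨FreeAlgebra.lift ℂ (kGenOp (W := W) M), by
    intro a b h
    induction h with
    | c_sq i =>
      simp only [map_mul, map_one, FreeAlgebra.lift_ι_apply, kGenOp, actTensor_mul]
      rw [tauRefl_mul_self, K.c_mul_self, actTensor_one]
    | e_sq i =>
      simp only [map_mul, map_one, FreeAlgebra.lift_ι_apply, kGenOp, actTensor_mul]
      rw [K.e_mul_self, mul_one, actTensor_one]
    | cc i j h =>
      simp only [map_mul, map_neg, FreeAlgebra.lift_ι_apply, kGenOp, actTensor_mul]
      rw [tauRefl_comm, K.c_mul_c h, actTensor_neg]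
    | ee i j h =>
      simp only [map_mul, map_neg, FreeAlgebra.lift_ι_apply, kGenOp, actTensor_mul]
      rw [K.e_mul_e h, actTensor_neg]
    | ce i j =>
      simp only [map_mul, map_neg, FreeAlgebra.lift_ι_apply, kGenOp, actTensor_mul]
      rw [K.c_mul_e, actTensor_neg, mul_one, one_mul]
    | w_one =>
      simp only [map_one, FreeAlgebra.lift_ι_apply, kGenOp]
      rw [K.w_one, OneMemClass.coe_one, actTensor_one]
    | w_mul g h =>
      simp only [map_mul, FreeAlgebra.lift_ι_apply, kGenOp, actTensor_mul]
      rw [K.w_mul, Subgroup.coe_mul]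
    | wc g i =>
      simp only [map_mul, map_smul, FreeAlgebra.lift_ι_apply, kGenOp, actTensor_mul]
      -- On the polynomial factor the relation is $g\tau_i=\tau_{g(i)}g$ without sign; the sign
      -- comes from $K$ alone.
      rw [K.w_mul_c, mul_tauRefl, actTensor_smul, sgn_eq]
    | we g i =>
      simp only [map_mul, map_smul, FreeAlgebra.lift_ι_apply, kGenOp, actTensor_mul]
      rw [K.w_mul_e, mul_one, one_mul, actTensor_smul, sgn_eq]⟩

theorem kRep_c (i : Fin n) : kRep M (K.c i : K W) = actTensor W M (tauRefl i) (K.c i) := by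
  refine (RingQuot.liftAlgHom_mkAlgHom_apply ℂ _ _ _).trans ?_
  rw [FreeAlgebra.lift_ι_apply]; rfl

theorem kRep_e (i : Fin n) : kRep M (K.e i : K W) = actTensor W M 1 (K.e i) := by
  refine (RingQuot.liftAlgHom_mkAlgHom_apply ℂ _ _ _).trans ?_
  rw [FreeAlgebra.lift_ι_apply]; rfl

theorem kRep_w (g : W) : kRep M (K.w g) = actTensor W M g (K.w g) := by
  refine (RingQuot.liftAlgHom_mkAlgHom_apply ℂ _ _ _).trans ?_
  rw [FreeAlgebra.lift_ι_apply]; rfl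

/-- `K` acts on `1 ⊗ M` as on `M`. -/
theorem kRep_one_tmul (a : K W) (m : M) : kRep M a (1 ⊗ₜ m) = 1 ⊗ₜ (a • m) := by
  induction a using K.induction generalizing m with
  | algebraMap r => simp [Algebra.algebraMap_eq_smul_one, TensorProduct.tmul_smul]
  | c i => rw [kRep_c, actTensor_tmul, map_one]
  | e i => rw [kRep_e, actTensor_tmul, map_one]
  | w g => rw [kRep_w, actTensor_tmul, map_one]
  | add a b ha hb => rw [map_add, LinearMap.add_apply, ha, hb, add_smul, TensorProduct.tmul_add]
  | mul a b ha hb => rw [map_mul, Module.End.mul_apply, hb, ha, mul_smul]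

end Rep

/-! ### Dunkl data and the induced module -/

section Datum

variable {W : Subgroup (SignedPerm n)} (br : Fin n → Fin n → K W)
variable {M : Type*} [AddCommGroup M] [Module ℂ M] [Module (K W) M] [IsScalarTower ℂ (K W) M]

/-- The operators `Y_i` on `ℂ[x_1, …, x_n] ⊗ M` satisfy the relations of the `y_i` with `K`. -/
structure KEquivariant (Y : Fin n → Module.End ℂ (PolyTensor n M)) [Module (K W) M]
    [IsScalarTower ℂ (K W) M] (κ : K W →ₐ[ℂ] Module.End ℂ (PolyTensor n M)) : Prop where
  w_mul : ∀ (g : W) i, κ (K.w g) * Y i =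
    sgn (g : SignedPerm n) i • (Y (perm (g : SignedPerm n) i) * κ (K.w g))
  c_mul : ∀ k i, κ (K.c k) * Y i = Y i * κ (K.c k)
  e_mul : ∀ k i, κ (K.e k) * Y i = (if k = i then (-1 : ℂ) else 1) • (Y i * κ (K.e k))

/-- Brackets `br i j` that are compatible with `K` and satisfy the Jacobi identity, together with
operators `D i` on `ℂ[x_1, …, x_n] ⊗ M` that vanish on `1 ⊗ M` and have brackets `br i j` with
multiplication by `x_j`. -/
structure DunklDatum (D : Fin n → Module.End ℂ (PolyTensor n M)) : Prop where
  one_tmul : ∀ i m, D i (1 ⊗ₜ m) = 0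
  mul_mulX : ∀ i j, D i * mulX M j = mulX M j * D i + kRep M (br i j)
  w_mul : ∀ (g : W) i j, K.w g * br i j =
    (sgn (g : SignedPerm n) i * sgn (g : SignedPerm n) j) •
      (br (perm (g : SignedPerm n) i) (perm (g : SignedPerm n) j) * K.w g)
  c_mul : ∀ k i j, K.c k * br i j = (if k = j then (-1 : ℂ) else 1) • (br i j * K.c k)
  e_mul : ∀ k i j, K.e k * br i j = (if k = i then (-1 : ℂ) else 1) • (br i j * K.e k)
  jacobi : ∀ Y : Fin n → Module.End ℂ (PolyTensor n M), KEquivariant Y (kRep (W := W) M) →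
    ∀ i j k, i ≠ j → kRep M (br i k) * Y j + Y i * kRep M (br j k) =
      kRep M (br j k) * Y i + Y j * kRep M (br i k)

/-! ### Linearity, commutation relations and the representation attached to a Dunkl datum -/

namespace DunklDatum

variable {br} {D : Fin n → Module.End ℂ (PolyTensor n M)}

/-- The Jacobi condition quantifies over all equivariant families $Y$ instead of taking $Y=D$. This
makes it linear in the brackets, so no cross terms arise and data can be added. -/
theorem add {br' : Fin n → Fin n → K W} {D' : Fin n → Module.End ℂ (PolyTensor n M)}
    (h : DunklDatum br D) (h' : DunklDatum br' D') :
    DunklDatum (fun i j => br i j + br' i j) (fun i => D i + D' i) where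
  one_tmul i m := by rw [LinearMap.add_apply, h.one_tmul, h'.one_tmul, add_zero]
  mul_mulX i j := by
    rw [add_mul, h.mul_mulX, h'.mul_mulX, map_add, mul_add]
    abel
  w_mul g i j := by rw [mul_add, h.w_mul, h'.w_mul, add_mul, smul_add]
  c_mul k i j := by rw [mul_add, h.c_mul, h'.c_mul, add_mul, smul_add]
  e_mul k i j := by rw [mul_add, h.e_mul, h'.e_mul, add_mul, smul_add]
  jacobi Y hY i j k hij := by
    rw [map_add, map_add, add_mul, mul_add, add_mul, mul_add, add_add_add_comm,
      h.jacobi Y hY i j k hij, h'.jacobi Y hY i j k hij, add_add_add_comm]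

theorem smul (h : DunklDatum br D) (r : ℂ) :
    DunklDatum (fun i j => r • br i j) (fun i => r • D i) where
  one_tmul i m := by rw [LinearMap.smul_apply, h.one_tmul, smul_zero]
  mul_mulX i j := by rw [smul_mul_assoc, h.mul_mulX, smul_add, map_smul, mul_smul_comm]
  w_mul g i j := by rw [mul_smul_comm, h.w_mul, smul_mul_assoc, smul_comm]
  c_mul k i j := by rw [mul_smul_comm, h.c_mul, smul_mul_assoc, smul_comm]
  e_mul k i j := by rw [mul_smul_comm, h.e_mul, smul_mul_assoc, smul_comm]
  jacobi Y hY i j k hij := by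
    rw [map_smul, map_smul, smul_mul_assoc, mul_smul_comm, smul_mul_assoc, mul_smul_comm,
      ← smul_add, h.jacobi Y hY i j k hij, smul_add]

/-- If $P$ permutes the $x_j$ up to scalars and the brackets compatibly, then both sides kill
$1\otimes M$ and have the same commutation with every $x_j$. All relations between the $y_i$ and $K$
are instances. -/
theorem mul_comm_of_bracket (h : DunklDatum br D) {i i' : Fin n} {P : Module.End ℂ (PolyTensor n M)}
    {σ : Fin n → Fin n} {α : Fin n → ℂ} {β : ℂ}
    (hX : ∀ j, P * mulX M j = α j • (mulX M (σ j) * P))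
    (h1 : ∀ m : M, ∃ m' : M, P (1 ⊗ₜ m) = 1 ⊗ₜ m')
    (hbr : ∀ j, P * kRep M (br i j) = (β * α j) • (kRep M (br i' (σ j)) * P)) :
    P * D i = β • (D i' * P) := by
  refine eq_of_mul_mulX (fun j => α j • mulX M (σ j))
    (fun j => (β * α j) • (kRep M (br i' (σ j)) * P)) (fun m => ?_) (fun j => ?_) (fun j => ?_)
  · obtain ⟨m', hm'⟩ := h1 m
    simp [h.one_tmul, hm']
  · rw [mul_assoc, h.mul_mulX, mul_add, ← mul_assoc, hX, hbr, smul_mul_assoc, smul_mul_assoc,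
      mul_assoc]
  · rw [smul_mul_assoc, mul_assoc, hX, mul_smul_comm, ← mul_assoc, h.mul_mulX, add_mul, smul_add,
      smul_add, smul_smul, smul_smul, smul_mul_assoc, mul_smul_comm, smul_smul, mul_assoc,
      mul_comm (α j)]

theorem kEquivariant (h : DunklDatum br D) : KEquivariant D (kRep (W := W) M) where
  w_mul g i := by
    refine h.mul_comm_of_bracket (σ := perm (g : SignedPerm n)) (α := sgn (g : SignedPerm n))
      (fun j => ?_) (fun m => ⟨_, kRep_one_tmul M _ m⟩) (fun j => ?_)
    · rw [kRep_w, actTensor_mul_mulX]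
    · rw [← map_mul, h.w_mul, map_smul, map_mul]
  c_mul k i := by
    have := h.mul_comm_of_bracket (P := kRep M (K.c k : K W)) (i := i) (i' := i) (σ := id)
      (α := fun j => if k = j then (-1 : ℂ) else 1) (β := 1)
      (fun j => ?_) (fun m => ⟨_, kRep_one_tmul M _ m⟩) (fun j => ?_)
    · rwa [one_smul] at this
    · rw [kRep_c, actTensor_mul_mulX, sgn_eq, usgn_tauRefl, perm_tauRefl]
      by_cases hj : j = k
      · simp [hj]
      · simp [hj, Ne.symm hj]
    · rw [← map_mul, h.c_mul, map_smul, map_mul, one_mul]; rfl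
  e_mul k i := by
    refine h.mul_comm_of_bracket (σ := id) (α := fun j => 1)
      (fun j => ?_) (fun m => ⟨_, kRep_one_tmul M _ m⟩) (fun j => ?_)
    · rw [kRep_e, actTensor_mul_mulX]
      simp [sgn, perm]
    · rw [← map_mul, h.e_mul, map_smul, map_mul, mul_one]; rfl

/-- Both products kill $1\otimes M$, and $[D_iD_j,x_k]=b_{ik}D_j+D_ib_{jk}$ is symmetric in $i,j$ by
the Jacobi condition at $Y=D$. -/
theorem comm (h : DunklDatum br D) (i j : Fin n) : D i * D j = D j * D i := by
  rcases eq_or_ne i j with rfl | hij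
  · rfl
  have hJ := h.jacobi D h.kEquivariant i j
  refine eq_of_mul_mulX (fun k => mulX M k)
    (fun k => kRep M (br i k) * D j + D i * kRep M (br j k)) (fun m => ?_) (fun k => ?_)
    (fun k => ?_)
  · simp [h.one_tmul]
  · rw [mul_assoc, h.mul_mulX, mul_add, ← mul_assoc, h.mul_mulX, add_mul, mul_assoc, add_assoc]
  · rw [hJ k hij, mul_assoc, h.mul_mulX, mul_add, ← mul_assoc, h.mul_mulX, add_mul, mul_assoc,
      add_assoc]

/-- The operators by which the generators of the double affine Hecke algebra act. -/
noncomputable def genOp (D : Fin n → Module.End ℂ (PolyTensor n M)) :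
    HGen W → Module.End ℂ (PolyTensor n M)
  | HGen.x i => mulX M i
  | HGen.y i => D i
  | HGen.k a => kRep M a

/-- The representation of the double affine Hecke algebra on `ℂ[x_1, …, x_n] ⊗ M`. -/
noncomputable def rep (h : DunklDatum br D) : H W br →ₐ[ℂ] Module.End ℂ (PolyTensor n M) :=
  RingQuot.liftAlgHom ℂ ⟨FreeAlgebra.lift ℂ (genOp D), by
    intro a b hr
    induction hr with
    | k_add a b => simp only [map_add, FreeAlgebra.lift_ι_apply, genOp]
    | k_mul a b => simp only [map_mul, FreeAlgebra.lift_ι_apply, genOp]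
    | k_algebraMap r => simp only [FreeAlgebra.lift_ι_apply, genOp, AlgHom.commutes]
    | xx i j =>
      simp only [map_mul, FreeAlgebra.lift_ι_apply, genOp]
      exact mulX_comm M i j
    | yy i j =>
      simp only [map_mul, FreeAlgebra.lift_ι_apply, genOp]
      exact h.comm i j
    | wx g i =>
      simp only [map_mul, map_smul, FreeAlgebra.lift_ι_apply, genOp]
      rw [kRep_w, actTensor_mul_mulX]
    | wy g i =>
      simp only [map_mul, map_smul, FreeAlgebra.lift_ι_apply, genOp]
      exact h.kEquivariant.w_mul g i
    | ex i j =>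
      simp only [map_mul, FreeAlgebra.lift_ι_apply, genOp]
      rw [kRep_e, actTensor_mul_mulX]
      simp [sgn, perm]
    | cx i j =>
      simp only [map_mul, map_smul, FreeAlgebra.lift_ι_apply, genOp]
      rw [kRep_c, actTensor_mul_mulX, sgn_eq, usgn_tauRefl, perm_tauRefl]
      by_cases hj : j = i
      · simp [hj]
      · simp [hj, Ne.symm hj]
    | cy i j =>
      simp only [map_mul, FreeAlgebra.lift_ι_apply, genOp]
      exact h.kEquivariant.c_mul i j
    | ey i j =>
      simp only [map_mul, map_smul, FreeAlgebra.lift_ι_apply, genOp]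
      exact h.kEquivariant.e_mul i j
    | yx i j =>
      simp only [map_mul, map_sub, FreeAlgebra.lift_ι_apply, genOp]
      exact sub_eq_of_eq_add' (h.mul_mulX i j)⟩

theorem rep_x (h : DunklDatum br D) (i : Fin n) : h.rep (H.x br i) = mulX M i := by
  refine (RingQuot.liftAlgHom_mkAlgHom_apply ℂ _ _ _).trans ?_
  rw [FreeAlgebra.lift_ι_apply]; rfl

theorem rep_y (h : DunklDatum br D) (i : Fin n) : h.rep (H.y br i) = D i := by
  refine (RingQuot.liftAlgHom_mkAlgHom_apply ℂ _ _ _).trans ?_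
  rw [FreeAlgebra.lift_ι_apply]; rfl

theorem rep_ofK (h : DunklDatum br D) (a : K W) : h.rep (H.ofK br a) = kRep M a := by
  refine (RingQuot.liftAlgHom_mkAlgHom_apply ℂ _ _ _).trans ?_
  rw [FreeAlgebra.lift_ι_apply]; rfl

theorem rep_polyX (h : DunklDatum br D) (f : MvPolynomial (Fin n) ℂ) (m : M) :
    h.rep (H.polyX br f) (1 ⊗ₜ m) = f ⊗ₜ m := by
  induction f using MvPolynomial.induction_on with
  | C r =>
    rw [← MvPolynomial.algebraMap_eq, AlgHom.commutes, AlgHom.commutes,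
      Algebra.algebraMap_eq_smul_one, Algebra.algebraMap_eq_smul_one]
    rfl
  | add p q hp hq => rw [map_add, map_add, LinearMap.add_apply, hp, hq, TensorProduct.add_tmul]
  | mul_X p j hp =>
    rw [mul_comm, map_mul, map_mul, Module.End.mul_apply, hp, H.polyX_X, h.rep_x, mulX_tmul]

/-- $1\otimes M$ is a copy of any trivial extension, since this holds on the generators of
$\mathfrak H_y$. It gives both uniqueness of $\rho$ and compatibility with the balancing relations.
-/
theorem rep_one_tmul (h : DunklDatum br D) {ρ : H.Hy br →ₐ[ℂ] Module.End ℂ M}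
    (hρ : IsTrivialExtension br M ρ) (b : H.Hy br) (m : M) :
    h.rep b (1 ⊗ₜ m) = 1 ⊗ₜ ρ b m := by
  obtain ⟨b, hb⟩ := b
  induction hb using Algebra.adjoin_induction generalizing m with
  | mem b hb =>
    rcases hb with ⟨a, rfl⟩ | ⟨i, rfl⟩
    · have := hρ.ofK_apply a m
      rw [H.hyOfK] at this
      rw [this, h.rep_ofK, kRep_one_tmul]
    · have := hρ.y_apply i m
      rw [H.hyY] at this
      rw [this, h.rep_y, h.one_tmul, TensorProduct.tmul_zero]
  | algebraMap r =>
    have : (⟨algebraMap ℂ (H W br) r, (H.Hy br).algebraMap_mem r⟩ : H.Hy br) =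
      algebraMap ℂ _ r := rfl
    simp [this, Module.algebraMap_end_apply, TensorProduct.tmul_smul]
  | add a b ha hb iha ihb =>
    have : (⟨a + b, add_mem ha hb⟩ : H.Hy br) = ⟨a, ha⟩ + ⟨b, hb⟩ := rfl
    rw [map_add, LinearMap.add_apply, iha, ihb, this, map_add, LinearMap.add_apply,
      TensorProduct.tmul_add]
  | mul a b ha hb iha ihb =>
    have : (⟨a * b, mul_mem ha hb⟩ : H.Hy br) = ⟨a, ha⟩ * ⟨b, hb⟩ := rfl
    rw [map_mul, Module.End.mul_apply, ihb, iha, this, map_mul, Module.End.mul_apply]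

/-! ### Existence and uniqueness of the extension to `ℌ_y` -/

variable (n M) in
/-- Evaluation at `x = 0`. -/
noncomputable def evalZero : PolyTensor n M →ₗ[ℂ] M :=
  (TensorProduct.lid ℂ M).toLinearMap ∘ₗ
    TensorProduct.map (MvPolynomial.aeval (fun _ : Fin n => (0 : ℂ))).toLinearMap LinearMap.id

theorem evalZero_one_tmul (m : M) : evalZero n M (1 ⊗ₜ m) = m := by
  simp [evalZero]

/-- Stability of $1\otimes M$ under $\mathfrak H_y$, proved without presupposing an extension
$\rho$, because it serves to construct one. -/
theorem exists_rep_one_tmul (h : DunklDatum br D) (b : H.Hy br) (m : M) :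
    ∃ m' : M, h.rep b (1 ⊗ₜ m) = 1 ⊗ₜ m' := by
  obtain ⟨b, hb⟩ := b
  induction hb using Algebra.adjoin_induction generalizing m with
  | mem b hb =>
    rcases hb with ⟨a, rfl⟩ | ⟨i, rfl⟩
    · exact ⟨a • m, by rw [h.rep_ofK, kRep_one_tmul]⟩
    · exact ⟨0, by rw [h.rep_y, h.one_tmul, TensorProduct.tmul_zero]⟩
  | algebraMap r => exact ⟨r • m, by simp [Module.algebraMap_end_apply, TensorProduct.tmul_smul]⟩
  | add a b ha hb iha ihb =>
    obtain ⟨p, hp⟩ := iha m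
    obtain ⟨q, hq⟩ := ihb m
    exact ⟨p + q, by rw [map_add, LinearMap.add_apply, hp, hq, TensorProduct.tmul_add]⟩
  | mul a b ha hb iha ihb =>
    obtain ⟨p, hp⟩ := ihb m
    obtain ⟨q, hq⟩ := iha p
    exact ⟨q, by rw [map_mul, Module.End.mul_apply, hp, hq]⟩

theorem rep_one_tmul_evalZero (h : DunklDatum br D) (b : H.Hy br) (m : M) :
    h.rep b (1 ⊗ₜ m) = 1 ⊗ₜ evalZero n M (h.rep b (1 ⊗ₜ m)) := by
  obtain ⟨m', hm'⟩ := h.exists_rep_one_tmul b m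
  rw [hm', evalZero_one_tmul]

/-- The extension of `M` to `ℌ_y`. -/
noncomputable def extension (h : DunklDatum br D) : H.Hy br →ₐ[ℂ] Module.End ℂ M :=
  AlgHom.ofLinearMap
    { toFun b := evalZero n M ∘ₗ h.rep b ∘ₗ TensorProduct.mk ℂ _ M 1
      map_add' a b := by ext m; simp
      map_smul' r b := by ext m; simp }
    (by ext m; simp [evalZero_one_tmul])
    -- Multiplicativity: $b\cdot(1\otimes m)$ already lies in $1\otimes M$, so evaluating at $x=0$
    -- before applying $a$ loses nothing.
    (fun a b => by
      ext m
      have := h.rep_one_tmul_evalZero b m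
      simp only [LinearMap.coe_mk, AddHom.coe_mk, LinearMap.comp_apply, Module.End.mul_apply,
        TensorProduct.mk_apply, MulMemClass.coe_mul, map_mul]
      rw [← this])

theorem extension_apply (h : DunklDatum br D) (b : H.Hy br) (m : M) :
    h.extension b m = evalZero n M (h.rep b (1 ⊗ₜ m)) := rfl

theorem isTrivialExtension_extension (h : DunklDatum br D) :
    IsTrivialExtension br M h.extension where
  ofK_apply a m := by
    rw [extension_apply, H.hyOfK, h.rep_ofK, kRep_one_tmul, evalZero_one_tmul]
  y_apply i m := by rw [extension_apply, H.hyY, h.rep_y, h.one_tmul, map_zero]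

theorem eq_extension (h : DunklDatum br D) {ρ : H.Hy br →ₐ[ℂ] Module.End ℂ M}
    (hρ : IsTrivialExtension br M ρ) : ρ = h.extension := by
  ext b m
  rw [extension_apply, h.rep_one_tmul hρ, evalZero_one_tmul]

end DunklDatum

/-! ### The canonical map to the induced module -/

section Canonical

variable {br} (ρ : H.Hy br →ₐ[ℂ] Module.End ℂ M)

omit [Module (K W) M] [IsScalarTower ℂ (K W) M]

theorem smul_indMk (a h : H W br) (m : M) : a • indMk br ρ h m = indMk br ρ (a * h) m := rfl

theorem indMk_mul (h : H W br) (b : H.Hy br) (m : M) :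
    indMk br ρ (h * b) m = indMk br ρ h (ρ b m) :=
  (Submodule.Quotient.eq _).2 (Submodule.subset_span ⟨h, b, m, rfl⟩)

/-- The canonical map `f ⊗ m ↦ f(x) ⊗ m`. -/
noncomputable def toInd : PolyTensor n M →ₗ[ℂ] Ind br ρ :=
  ((balancing br ρ).mkQ.restrictScalars ℂ) ∘ₗ
    TensorProduct.map (H.polyX br).toLinearMap LinearMap.id

theorem toInd_tmul (f : MvPolynomial (Fin n) ℂ) (m : M) :
    toInd ρ (f ⊗ₜ m) = indMk br ρ (H.polyX br f) m := rfl

theorem x_smul_toInd (i : Fin n) (v : PolyTensor n M) :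
    H.x br i • toInd ρ v = toInd ρ (mulX M i v) := by
  induction v using TensorProduct.induction_on with
  | zero => rw [map_zero, map_zero, map_zero, smul_zero]
  | tmul f m => rw [mulX_tmul, toInd_tmul, toInd_tmul, smul_indMk, map_mul, H.polyX_X]
  | add v w hv hw => rw [map_add, map_add, map_add, smul_add, hv, hw]

end Canonical

section

variable {br} {ρ : H.Hy br →ₐ[ℂ] Module.End ℂ M}

omit [IsScalarTower ℂ (K W) M] in
theorem indMk_mul_ofK (hρ : IsTrivialExtension br M ρ) (h : H W br) (a : K W) (m : M) :
    indMk br ρ (h * H.ofK br a) m = indMk br ρ h (a • m) := by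
  rw [← hρ.ofK_apply]
  exact indMk_mul ρ h (H.hyOfK br a) m

theorem smul_toInd_of_actTensor (hρ : IsTrivialExtension br M ρ) (a : K W) (g : SignedPerm n)
    (h : ∀ j, H.ofK br a * H.x br j = sgn g j • (H.x br (perm g j) * H.ofK br a))
    (v : PolyTensor n M) :
    H.ofK br a • toInd ρ v = toInd ρ (actTensor W M g a v) := by
  induction v using TensorProduct.induction_on with
  | zero => rw [map_zero, map_zero, map_zero, smul_zero]
  | tmul f m =>
    rw [actTensor_tmul, toInd_tmul, toInd_tmul, smul_indMk, H.mul_polyX br _ g h,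
      indMk_mul_ofK hρ]
  | add v w hv hw => rw [map_add, map_add, map_add, smul_add, hv, hw]

theorem ofK_smul_toInd (hρ : IsTrivialExtension br M ρ) (a : K W) (v : PolyTensor n M) :
    H.ofK br a • toInd ρ v = toInd ρ (kRep M a v) := by
  induction a using K.induction generalizing v with
  | algebraMap r =>
    rw [H.ofK_algebraMap, AlgHom.commutes, algebraMap_smul, Module.algebraMap_end_apply, map_smul]
  | c i =>
    rw [kRep_c]
    refine smul_toInd_of_actTensor hρ _ _ (fun j => ?_) v
    rw [H.ofK_c_mul_x, sgn_eq, usgn_tauRefl, perm_tauRefl]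
    by_cases hj : j = i
    · simp [hj]
    · simp [hj, Ne.symm hj]
  | e i =>
    rw [kRep_e]
    refine smul_toInd_of_actTensor hρ _ _ (fun j => ?_) v
    rw [H.ofK_e_mul_x]
    simp [sgn, perm]
  | w g =>
    rw [kRep_w]
    exact smul_toInd_of_actTensor hρ _ _ (fun j => H.ofK_w_mul_x br g j) v
  | add a b ha hb => rw [H.ofK_add, add_smul, ha, hb, map_add, LinearMap.add_apply, map_add]
  | mul a b ha hb => rw [H.ofK_mul, mul_smul, hb, ha, map_mul, Module.End.mul_apply]

end

/-! ### Equivariance and bijectivity of the canonical map -/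

namespace DunklDatum

variable {br} {D : Fin n → Module.End ℂ (PolyTensor n M)} {ρ : H.Hy br →ₐ[ℂ] Module.End ℂ M}

/-- The determination principle again, now for maps into the induced module: there too $y_i$ kills
the image of $1\otimes M$ and has the brackets $b_{ij}$ with the $x_j$. -/
theorem y_smul_toInd (h : DunklDatum br D) (hρ : IsTrivialExtension br M ρ) (i : Fin n)
    (v : PolyTensor n M) : H.y br i • toInd ρ v = toInd ρ (D i v) := by
  have key : (Algebra.lsmul ℂ ℂ (Ind br ρ) (H.y br i)) ∘ₗ toInd ρ = toInd ρ ∘ₗ D i := by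
    refine eq_of_comm_mulX (fun j => Algebra.lsmul ℂ ℂ (Ind br ρ) (H.x br j))
      (fun j v => toInd ρ (kRep M (br i j) v)) (fun m => ?_) (fun j v => ?_) (fun j v => ?_)
    · have e : H.y br i • toInd ρ (1 ⊗ₜ m) = 0 := by
        -- Written as $1\cdot y_i$, the element $y_i\in\mathfrak H_y$ can be moved across the tensor
        -- sign, where it acts as zero.
        rw [toInd_tmul, smul_indMk, map_one, mul_one, ← one_mul (H.y br i)]
        refine (indMk_mul ρ 1 (H.hyY br i) m).trans ?_
        rw [hρ.y_apply, indMk, TensorProduct.tmul_zero, map_zero]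
      simp [h.one_tmul, e]
    · simp only [LinearMap.comp_apply, Algebra.lsmul_coe]
      rw [← x_smul_toInd, ← ofK_smul_toInd hρ, smul_smul, H.y_mul_x, add_smul, smul_smul]
    · have e : D i (mulX M j v) = mulX M j (D i v) + kRep M (br i j) v :=
        LinearMap.congr_fun (h.mul_mulX i j) v
      simp only [LinearMap.comp_apply, Algebra.lsmul_coe]
      rw [e, map_add, ← x_smul_toInd]
  exact LinearMap.congr_fun key v

theorem smul_toInd (h : DunklDatum br D) (hρ : IsTrivialExtension br M ρ) (a : H W br)
    (v : PolyTensor n M) : a • toInd ρ v = toInd ρ (h.rep a v) := by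
  induction a using H.induction generalizing v with
  | algebraMap r =>
    rw [AlgHom.commutes, algebraMap_smul, Module.algebraMap_end_apply, map_smul]
  | x i => rw [h.rep_x, x_smul_toInd]
  | y i => rw [h.rep_y, h.y_smul_toInd hρ]
  | k a => rw [h.rep_ofK, ofK_smul_toInd hρ]
  | add a b ha hb => rw [add_smul, ha, hb, map_add, LinearMap.add_apply, map_add]
  | mul a b ha hb => rw [mul_smul, hb, ha, map_mul, Module.End.mul_apply]

/-- By equivariance $a\otimes m=a\cdot(1\otimes m)$ is the image of $a\cdot(1\otimes m)$ computed in
$\mathbb C[x]\otimes M$. -/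
theorem toInd_surjective (h : DunklDatum br D) (hρ : IsTrivialExtension br M ρ) :
    Function.Surjective (toInd ρ) := by
  intro z
  obtain ⟨z, rfl⟩ := Submodule.mkQ_surjective _ z
  induction z using TensorProduct.induction_on with
  | zero => exact ⟨0, by rw [map_zero, map_zero]⟩
  | tmul a m =>
    refine ⟨h.rep a (1 ⊗ₜ m), ?_⟩
    rw [← h.smul_toInd hρ, toInd_tmul, smul_indMk, map_one, mul_one]
    rfl
  | add z w hz hw =>
    obtain ⟨p, hp⟩ := hz
    obtain ⟨q, hq⟩ := hw
    exact ⟨p + q, by rw [map_add, map_add, hp, hq]⟩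

/-- The map `a ⊗ m ↦ a · (1 ⊗ m)` on `H ⊗ M`. -/
noncomputable def actOne (h : DunklDatum br D) : H W br ⊗[ℂ] M →ₗ[ℂ] PolyTensor n M :=
  TensorProduct.lift
    ((LinearMap.lcomp ℂ _ (TensorProduct.mk ℂ (MvPolynomial (Fin n) ℂ) M 1)) ∘ₗ
      h.rep.toLinearMap)

theorem actOne_tmul (h : DunklDatum br D) (a : H W br) (m : M) :
    h.actOne (a ⊗ₜ m) = h.rep a (1 ⊗ₜ m) := rfl

theorem actOne_smul (h : DunklDatum br D) (a : H W br) (z : H W br ⊗[ℂ] M) :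
    h.actOne (a • z) = h.rep a (h.actOne z) := by
  induction z using TensorProduct.induction_on with
  | zero => rw [smul_zero, map_zero, map_zero]
  | tmul b m =>
    rw [TensorProduct.smul_tmul', actOne_tmul, actOne_tmul, smul_eq_mul, map_mul,
      Module.End.mul_apply]
  | add z w hz hw => rw [smul_add, map_add, map_add, map_add, hz, hw]

/-- Hence $a\otimes m\mapsto a\cdot(1\otimes m)$ descends to the induced module, where it is a left
inverse of the canonical map. -/
theorem actOne_eq_zero (h : DunklDatum br D) (hρ : IsTrivialExtension br M ρ)
    {z : H W br ⊗[ℂ] M} (hz : z ∈ balancing br ρ) : h.actOne z = 0 := by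
  induction hz using Submodule.span_induction with
  | mem z hz =>
    obtain ⟨a, b, m, rfl⟩ := hz
    rw [map_sub, actOne_tmul, actOne_tmul, map_mul, Module.End.mul_apply, h.rep_one_tmul hρ,
      sub_self]
  | zero => exact map_zero _
  | add z w _ _ hz hw => rw [map_add, hz, hw, add_zero]
  | smul a z _ hz => rw [actOne_smul, hz, map_zero]

theorem toInd_injective (h : DunklDatum br D) (hρ : IsTrivialExtension br M ρ) :
    Function.Injective (toInd ρ) := by
  rw [injective_iff_map_eq_zero]
  intro v hv
  have key : h.actOne ∘ₗ TensorProduct.map (H.polyX br).toLinearMap LinearMap.id =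
      LinearMap.id := TensorProduct.ext' fun f m => h.rep_polyX f m
  rw [← LinearMap.id_apply (R := ℂ) v, ← key, LinearMap.comp_apply]
  exact h.actOne_eq_zero hρ ((Submodule.Quotient.mk_eq_zero _).1 hv)

theorem dunklRealization (h : DunklDatum br D) :
    DunklRealization br M fun i f m => D i (f ⊗ₜ m) := by
  refine ⟨⟨h.extension, h.isTrivialExtension_extension, fun ρ hρ => h.eq_extension hρ⟩,
    fun ρ hρ => ⟨LinearEquiv.ofBijective (toInd ρ) ⟨h.toInd_injective hρ, h.toInd_surjective hρ⟩,
      fun f m => rfl, fun i f m => ?_, fun g f m => ?_, fun i f m => ?_, fun i f m => ?_,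
      fun i f m => ?_⟩⟩
  · exact x_smul_toInd ρ i (f ⊗ₜ m)
  · refine (ofK_smul_toInd hρ _ (f ⊗ₜ m)).trans ?_
    rw [kRep_w]
    rfl
  · refine (ofK_smul_toInd hρ _ (f ⊗ₜ m)).trans ?_
    rw [kRep_c]
    rfl
  · refine (ofK_smul_toInd hρ _ (f ⊗ₜ m)).trans ?_
    rw [kRep_e, actTensor_tmul, act_one]
    rfl
  · exact h.y_smul_toInd hρ i (f ⊗ₜ m)

end DunklDatum

end Datum

/-! ### Divided differences -/

theorem dvd_sub_act_sEta (η : ℤˣ) {k i : Fin n} (hki : k ≠ i) (f : MvPolynomial (Fin n) ℂ) :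
    (MvPolynomial.X i - signC η • MvPolynomial.X k) ∣ f - act (sEta η k i) f := by
  rcases Int.units_eq_one_or η with rfl | rfl
  · simpa [sEta_one] using dvd_sub_act_sRefl k i f
  · simpa [sEta_neg_one] using dvd_sub_act_sBar k i hki f

theorem X_sub_smul_X_ne_zero (r : ℂ) {k i : Fin n} (hki : k ≠ i) :
    (MvPolynomial.X i - r • MvPolynomial.X k : MvPolynomial (Fin n) ℂ) ≠ 0 := by
  intro h
  -- At the $i$-th basis vector the linear form takes the value $1$.
  have := congrArg (MvPolynomial.eval (Pi.single i 1)) h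
  simp [MvPolynomial.smul_eval, hki] at this

theorem two_mul_X_ne_zero (i : Fin n) : (2 * MvPolynomial.X i : MvPolynomial (Fin n) ℂ) ≠ 0 :=
  mul_ne_zero two_ne_zero (MvPolynomial.X_ne_zero i)

/-- Exact quotients are unique in a domain, so identities of divided differences may be checked
after multiplication by $d$. -/
theorem exactDiv_eq {p d q : MvPolynomial (Fin n) ℂ} (hd : d ≠ 0) (h : d * q = p) :
    exactDiv p d = q :=
  mul_left_cancel₀ hd ((mul_exactDiv ⟨q, h.symm⟩).trans h.symm)

/-- The divided difference `f ↦ (f - f^g) / d`. -/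
noncomputable def divDiff (g : SignedPerm n) {d : MvPolynomial (Fin n) ℂ} (hd : d ≠ 0)
    (hdvd : ∀ f, d ∣ f - act g f) : Module.End ℂ (MvPolynomial (Fin n) ℂ) where
  toFun f := exactDiv (f - act g f) d
  map_add' p q := exactDiv_eq hd (by
    rw [mul_add, mul_exactDiv (hdvd p), mul_exactDiv (hdvd q), map_add]
    ring)
  map_smul' r p := exactDiv_eq hd (by
    rw [RingHom.id_apply, mul_smul_comm, mul_exactDiv (hdvd p), map_smul, smul_sub])

section

variable (g : SignedPerm n) {d : MvPolynomial (Fin n) ℂ} (hd : d ≠ 0)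
  (hdvd : ∀ f, d ∣ f - act g f)

theorem divDiff_apply (f : MvPolynomial (Fin n) ℂ) :
    divDiff g hd hdvd f = exactDiv (f - act g f) d := rfl

theorem divDiff_one : divDiff g hd hdvd 1 = 0 :=
  exactDiv_eq hd (by rw [map_one, sub_self, mul_zero])

/-- Twisted Leibniz rule, from $x_jf-x_j^gf^g=x_j(f-f^g)+(x_j-x_j^g)f^g$ divided by $d$. -/
theorem divDiff_X_mul {j : Fin n} {r : ℂ}
    (h : MvPolynomial.X j - act g (MvPolynomial.X j) = r • d) (f : MvPolynomial (Fin n) ℂ) :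
    divDiff g hd hdvd (MvPolynomial.X j * f) =
      MvPolynomial.X j * divDiff g hd hdvd f + r • act g f := by
  refine exactDiv_eq hd ?_
  rw [mul_add, mul_left_comm, divDiff_apply, mul_exactDiv (hdvd f), mul_smul_comm,
    ← smul_mul_assoc, ← h, map_mul]
  ring

end

/-! ### Divided differences tensored with elements of `K` -/

section Operators

variable {W : Subgroup (SignedPerm n)}
variable {M : Type*} [AddCommGroup M] [Module ℂ M] [Module (K W) M] [IsScalarTower ℂ (K W) M]

/-- The operator `f ⊗ m ↦ ∂ f ⊗ a m` for a divided difference `∂`. -/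
noncomputable def divTensor (W : Subgroup (SignedPerm n)) (M : Type*) [AddCommGroup M] [Module ℂ M]
    [Module (K W) M] [IsScalarTower ℂ (K W) M] (g : SignedPerm n) {d : MvPolynomial (Fin n) ℂ}
    (hd : d ≠ 0) (hdvd : ∀ f, d ∣ f - act g f) (a : K W) : Module.End ℂ (PolyTensor n M) :=
  TensorProduct.map (divDiff g hd hdvd) (Algebra.lsmul ℂ ℂ M a)

theorem divTensor_tmul (g : SignedPerm n) {d : MvPolynomial (Fin n) ℂ} (hd : d ≠ 0)
    (hdvd : ∀ f, d ∣ f - act g f) (a : K W) (f : MvPolynomial (Fin n) ℂ) (m : M) :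
    divTensor W M g hd hdvd a (f ⊗ₜ m) = exactDiv (f - act g f) d ⊗ₜ (a • m) := rfl

theorem divTensor_one_tmul (g : SignedPerm n) {d : MvPolynomial (Fin n) ℂ} (hd : d ≠ 0)
    (hdvd : ∀ f, d ∣ f - act g f) (a : K W) (m : M) :
    divTensor W M g hd hdvd a (1 ⊗ₜ m) = 0 := by
  rw [divTensor_tmul, ← divDiff_apply g hd hdvd, divDiff_one, TensorProduct.zero_tmul]

theorem divTensor_mul_mulX (g : SignedPerm n) {d : MvPolynomial (Fin n) ℂ} (hd : d ≠ 0)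
    (hdvd : ∀ f, d ∣ f - act g f) (a : K W) {j : Fin n} {r : ℂ}
    (h : MvPolynomial.X j - act g (MvPolynomial.X j) = r • d) :
    divTensor W M g hd hdvd a * mulX M j =
      mulX M j * divTensor W M g hd hdvd a + r • actTensor W M g a := by
  refine TensorProduct.ext' fun f m => ?_
  simp only [Module.End.mul_apply, mulX_tmul, divTensor_tmul, LinearMap.add_apply,
    LinearMap.smul_apply, actTensor_tmul]
  rw [← divDiff_apply g hd hdvd, divDiff_X_mul g hd hdvd h, TensorProduct.add_tmul,
    TensorProduct.smul_tmul', divDiff_apply]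

theorem X_sub_act_tauRefl_X (i j : Fin n) :
    (MvPolynomial.X j - act (tauRefl i) (MvPolynomial.X j) : MvPolynomial (Fin n) ℂ) =
      (if i = j then (1 : ℂ) else 0) • (2 * MvPolynomial.X i) := by
  rw [act_tauRefl_X]
  by_cases h : i = j
  · subst h; simp [two_mul]
  · simp [h, Ne.symm h]

theorem act_X (g : SignedPerm n) (j : Fin n) :
    act g (MvPolynomial.X j) = signC (usgn g j) • MvPolynomial.X (perm g j) := by
  rw [act, MvPolynomial.aeval_X, sgn_eq]

theorem X_sub_act_sEta_X (η : ℤˣ) {k i : Fin n} (hki : k ≠ i) (j : Fin n) :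
    (MvPolynomial.X j - act (sEta η k i) (MvPolynomial.X j) : MvPolynomial (Fin n) ℂ) =
      (if i = j then (1 : ℂ) else if k = j then -signC η else 0) •
        (MvPolynomial.X i - signC η • MvPolynomial.X k) := by
  rw [act_X, perm_sEta]
  rcases eq_or_ne i j with rfl | hi
  · rw [usgn_sEta_right η hki, Equiv.swap_apply_right, if_pos rfl, one_smul]
  rcases eq_or_ne k j with rfl | hk
  · rw [usgn_sEta_left η hki, Equiv.swap_apply_left, if_neg hi, if_pos rfl, smul_sub, smul_smul,
      neg_mul, signC_mul_self]
    module
  · rw [usgn_sEta_of_ne η hk.symm hi.symm, Equiv.swap_apply_of_ne_of_ne hk.symm hi.symm,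
      if_neg hi, if_neg hk, signC_one, one_smul, zero_smul, sub_self]

/-! ### The Dunkl data for sign changes -/

/-- The divided difference at `τ_i`, tensored with the action of `a`. -/
noncomputable def tauTensor (W : Subgroup (SignedPerm n)) (M : Type*) [AddCommGroup M] [Module ℂ M]
    [Module (K W) M] [IsScalarTower ℂ (K W) M] (i : Fin n) (a : K W) :
    Module.End ℂ (PolyTensor n M) :=
  divTensor W M (tauRefl i) (two_mul_X_ne_zero i) (dvd_sub_act_tauRefl i) a

theorem tauTensor_mul_mulX (i j : Fin n) (a : K W) : tauTensor W M i a * mulX M j =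
    mulX M j * tauTensor W M i a + (if i = j then (1 : ℂ) else 0) • actTensor W M (tauRefl i) a :=
  divTensor_mul_mulX _ _ _ a (X_sub_act_tauRefl_X i j)

/-- Diagonal brackets `[y_i, x_i] = z_i`. -/
noncomputable def brDiag (z : Fin n → K W) (i j : Fin n) : K W := if i = j then z i else 0

/-- Dunkl datum with `[y_i, x_j] = δ_{ij} z_i`. -/
theorem dunklDatum_brDiag (z : Fin n → K W)
    (hz : ∀ i, kRep M (z i) = actTensor W M (tauRefl i) (z i))
    (hw : ∀ (g : W) i, K.w g * z i = z (perm (g : SignedPerm n) i) * K.w g)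
    (hc : ∀ k i, K.c k * z i = (if k = i then (-1 : ℂ) else 1) • (z i * K.c k))
    (he : ∀ k i, K.e k * z i = (if k = i then (-1 : ℂ) else 1) • (z i * K.e k))
    (hY : ∀ Y : Fin n → Module.End ℂ (PolyTensor n M), KEquivariant Y (kRep (W := W) M) →
      ∀ i j, i ≠ j → kRep M (z i) * Y j = Y j * kRep M (z i)) :
    DunklDatum (brDiag z) (fun i => tauTensor W M i (z i)) where
  one_tmul i m := divTensor_one_tmul _ _ _ _ _
  mul_mulX i j := by
    rw [tauTensor_mul_mulX, brDiag]
    split_ifs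
    · rw [one_smul, hz]
    · rw [zero_smul, map_zero]
  w_mul g i j := by
    rw [brDiag, brDiag]
    by_cases h : i = j
    · subst h
      rw [if_pos rfl, if_pos rfl, hw, sgn_eq, signC_mul_self, one_smul]
    · rw [if_neg h, if_neg fun h' => h ((perm (g : SignedPerm n)).injective h'), mul_zero,
        zero_mul, smul_zero]
  c_mul k i j := by
    rw [brDiag]
    by_cases h : i = j
    · subst h
      rw [if_pos rfl, hc]
    · rw [if_neg h, mul_zero, zero_mul, smul_zero]
  e_mul k i j := by
    rw [brDiag]
    by_cases h : i = j
    · subst h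
      rw [if_pos rfl, he]
    · rw [if_neg h, mul_zero, zero_mul, smul_zero]
  jacobi Y hK i j k hij := by
    rw [brDiag, brDiag]
    rcases eq_or_ne i k with rfl | hi
    · rw [if_pos rfl, if_neg hij.symm, map_zero, mul_zero, zero_mul, add_zero, zero_add,
        hY Y hK i j hij]
    rcases eq_or_ne j k with rfl | hj
    · rw [if_pos rfl, if_neg hij, map_zero, mul_zero, zero_mul, add_zero, zero_add,
        hY Y hK j i hij.symm]
    · rw [if_neg hi, if_neg hj, map_zero, mul_zero, zero_mul]
      simp

/-- The $t$ term. On polynomials $c_i$ acts by $\tau_i$ and $e_i$ trivially, so $c_ie_i$ acts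
through $\tau_i$, as the divided difference at $\tau_i$ requires. -/
theorem dunklDatum_c_mul_e :
    DunklDatum (brDiag fun i => (K.c i * K.e i : K W))
      (fun i => tauTensor W M i (K.c i * K.e i)) := by
  refine dunklDatum_brDiag _ (fun i => ?_) (fun g i => ?_) (fun k i => ?_) (fun k i => ?_)
    (fun Y hY i j hij => ?_)
  · rw [map_mul, kRep_c, kRep_e, actTensor_mul, mul_one]
  · rw [← mul_assoc, K.w_mul_c, smul_mul_assoc, mul_assoc, K.w_mul_e, mul_smul_comm, smul_smul,
      signC_mul_self, one_smul, mul_assoc]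
  · by_cases h : k = i
    · subst h
      rw [if_pos rfl, mul_assoc (K.c k), ← neg_eq_iff_eq_neg.2 (K.c_mul_e k k), mul_neg,
        smul_neg, neg_smul, one_smul, neg_neg]
    · rw [if_neg h, one_smul, ← mul_assoc, K.c_mul_c h, neg_mul, mul_assoc, K.c_mul_e, mul_neg,
        neg_neg, mul_assoc]
  · by_cases h : k = i
    · subst h
      rw [if_pos rfl, ← mul_assoc, ← neg_eq_iff_eq_neg.2 (K.c_mul_e k k), neg_mul, neg_smul,
        one_smul]
    · rw [if_neg h, one_smul, ← mul_assoc, ← neg_eq_iff_eq_neg.2 (K.c_mul_e i k), neg_mul,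
        mul_assoc, K.e_mul_e h, mul_neg, neg_neg, mul_assoc]
  · rw [map_mul, mul_assoc, hY.e_mul, if_neg hij, one_smul, ← mul_assoc, hY.c_mul, mul_assoc]

theorem dunklDatum_tau (hW : ∀ i : Fin n, tauRefl i ∈ W) :
    DunklDatum (brDiag fun i => K.wE W (tauRefl i))
      (fun i => tauTensor W M i (K.wE W (tauRefl i))) := by
  have hw : ∀ i, K.wE W (tauRefl i) = K.w ⟨tauRefl i, hW i⟩ := fun i => K.wE_coe ⟨_, hW i⟩
  refine dunklDatum_brDiag _ (fun i => ?_) (fun g i => ?_) (fun k i => ?_) (fun k i => ?_)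
    (fun Y hY i j hij => ?_)
  · rw [hw, kRep_w]
  · rw [← K.wE_coe, ← K.wE_mul g.2 (hW i), mul_tauRefl, K.wE_mul (hW _) g.2]
  · rw [K.wE_tauRefl_mul_c, smul_smul]
    split_ifs <;> simp
  · rw [K.wE_tauRefl_mul_e, smul_smul]
    split_ifs <;> simp
  · rw [hw, hY.w_mul, perm_tauRefl, sgn_eq, usgn_tauRefl, if_neg hij.symm, signC_one, one_smul]

end Operators

/-! ### The Dunkl data for reflections -/

section Reflections

variable {W : Subgroup (SignedPerm n)}

namespace K

theorem wE_coe_mul_sEta {η : ℤˣ} {i j : Fin n} (hij : i ≠ j) (h : sEta η i j ∈ W)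
    (g : W) (h' : sEta (η * (usgn (g : SignedPerm n) i * usgn (g : SignedPerm n) j))
      (perm (g : SignedPerm n) i) (perm (g : SignedPerm n) j) ∈ W) :
    w g * wE W (sEta η i j) =
      wE W (sEta (η * (usgn (g : SignedPerm n) i * usgn (g : SignedPerm n) j))
        (perm (g : SignedPerm n) i) (perm (g : SignedPerm n) j)) * w g := by
  rw [← wE_coe, ← wE_mul g.2 h, mul_sEta _ _ hij, wE_mul h' g.2]

/-- The `η`-part `(1 + η c_i c_j)(1 + η e_j e_i) s` of the bracket `[y_i, x_j]`, up to sign. -/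
noncomputable def offDiag (W : Subgroup (SignedPerm n)) (η : ℤˣ) (i j : Fin n) : K W :=
  cc W η i j * ee W η j i * wE W (sEta η i j)

/-- The summand `(1 + η c_k c_i)(1 + η e_k e_i) s` of the bracket `[y_i, x_i]`, up to sign. -/
noncomputable def onDiag (W : Subgroup (SignedPerm n)) (η : ℤˣ) (k i : Fin n) : K W :=
  cc W η k i * ee W η k i * wE W (sEta η k i)

theorem w_mul_offDiag {η : ℤˣ} {i j : Fin n} (hij : i ≠ j) (h : sEta η i j ∈ W)
    (g : W) (h' : sEta (η * (usgn (g : SignedPerm n) i * usgn (g : SignedPerm n) j))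
      (perm (g : SignedPerm n) i) (perm (g : SignedPerm n) j) ∈ W) :
    w g * offDiag W η i j =
      offDiag W (η * (usgn (g : SignedPerm n) i * usgn (g : SignedPerm n) j))
        (perm (g : SignedPerm n) i) (perm (g : SignedPerm n) j) * w g := by
  have h1 := wE_mul_cc (W := W) η g i j
  have h2 := wE_mul_ee (W := W) η g j i
  rw [wE_coe] at h1 h2
  rw [offDiag, ← mul_assoc, ← mul_assoc, h1, mul_assoc _ (w g), h2, mul_assoc, mul_assoc,
    wE_coe_mul_sEta hij h g h', offDiag, mul_comm (usgn (g : SignedPerm n) j)]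
  simp only [mul_assoc]

theorem w_mul_onDiag {η : ℤˣ} {k i : Fin n} (hki : k ≠ i) (h : sEta η k i ∈ W)
    (g : W) (h' : sEta (η * (usgn (g : SignedPerm n) k * usgn (g : SignedPerm n) i))
      (perm (g : SignedPerm n) k) (perm (g : SignedPerm n) i) ∈ W) :
    w g * onDiag W η k i =
      onDiag W (η * (usgn (g : SignedPerm n) k * usgn (g : SignedPerm n) i))
        (perm (g : SignedPerm n) k) (perm (g : SignedPerm n) i) * w g := by
  have h1 := wE_mul_cc (W := W) η g k i
  have h2 := wE_mul_ee (W := W) η g k i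
  rw [wE_coe] at h1 h2
  rw [onDiag, ← mul_assoc, ← mul_assoc, h1, mul_assoc _ (w g), h2, mul_assoc, mul_assoc,
    wE_coe_mul_sEta hki h g h', onDiag]
  simp only [mul_assoc]

theorem c_mul_offDiag (η : ℤˣ) {i j : Fin n} (hij : i ≠ j) (k : Fin n) :
    c k * offDiag W η i j = (if k = j then (-1 : ℂ) else 1) • (offDiag W η i j * c k) := by
  rw [offDiag, (commute_cc_ee η i j j i).eq, mul_assoc, ← mul_assoc (c k),
    (commute_c_ee η k j i).eq, mul_assoc, c_mul_cc_mul_wE η hij, mul_smul_comm, ← mul_assoc]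

theorem c_mul_onDiag (η : ℤˣ) {k i : Fin n} (hki : k ≠ i) (l : Fin n) :
    c l * onDiag W η k i = (if l = i then (-1 : ℂ) else 1) • (onDiag W η k i * c l) := by
  rw [onDiag, (commute_cc_ee η k i k i).eq, mul_assoc, ← mul_assoc (c l),
    (commute_c_ee η l k i).eq, mul_assoc, c_mul_cc_mul_wE η hki, mul_smul_comm, ← mul_assoc]

/-- The factor is $1+\eta e_je_i$, in the order opposite to that of the $c$'s. This puts the sign at
$i$, matching $e_iy_i=-y_ie_i$, while the sign for the $c$'s is at $j$, matching $c_jx_j=-x_jc_j$.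
-/
theorem e_mul_offDiag (η : ℤˣ) {i j : Fin n} (hij : i ≠ j) (k : Fin n) :
    e k * offDiag W η i j = (if k = i then (-1 : ℂ) else 1) • (offDiag W η i j * e k) := by
  rw [offDiag, sEta_comm, mul_assoc, ← mul_assoc (e k), (commute_e_cc η k i j).eq, mul_assoc,
    e_mul_ee_mul_wE η hij.symm, mul_smul_comm, ← mul_assoc]

theorem e_mul_onDiag (η : ℤˣ) {k i : Fin n} (hki : k ≠ i) (l : Fin n) :
    e l * onDiag W η k i = (if l = i then (-1 : ℂ) else 1) • (onDiag W η k i * e l) := by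
  rw [onDiag, mul_assoc, ← mul_assoc (e l), (commute_e_cc η l k i).eq, mul_assoc,
    e_mul_ee_mul_wE η hki, mul_smul_comm, ← mul_assoc]

theorem cc_swap (η : ℤˣ) {i k : Fin n} (h : i ≠ k) :
    cc W η i k = 1 + (-signC η) • (c k * c i) := by
  rw [cc, c_mul_c h, smul_neg, neg_smul]

end K

open K

/-- The brackets `[y_i, x_j]` for the reflections `s^η`, with `u = 1`. -/
noncomputable def brEta (W : Subgroup (SignedPerm n)) (η : ℤˣ) (i j : Fin n) : K W :=
  if i = j then (-1 : ℂ) • ∑ k ∈ Finset.univ.erase i, onDiag W η k i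
  else signC η • offDiag W η i j

theorem c_mul_brEta (η : ℤˣ) (k i j : Fin n) :
    c k * brEta W η i j = (if k = j then (-1 : ℂ) else 1) • (brEta W η i j * c k) := by
  rw [brEta]
  by_cases h : i = j
  · subst h
    rw [if_pos rfl, mul_smul_comm, smul_mul_assoc, Finset.mul_sum, Finset.sum_mul,
      Finset.sum_congr rfl fun l hl => c_mul_onDiag η (Finset.ne_of_mem_erase hl) k,
      ← Finset.smul_sum, smul_comm]
  · rw [if_neg h, mul_smul_comm, smul_mul_assoc, smul_comm, c_mul_offDiag η h]

theorem e_mul_brEta (η : ℤˣ) (k i j : Fin n) :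
    e k * brEta W η i j = (if k = i then (-1 : ℂ) else 1) • (brEta W η i j * e k) := by
  rw [brEta]
  by_cases h : i = j
  · subst h
    rw [if_pos rfl, mul_smul_comm, smul_mul_assoc, Finset.mul_sum, Finset.sum_mul,
      Finset.sum_congr rfl fun l hl => e_mul_onDiag η (Finset.ne_of_mem_erase hl) k,
      ← Finset.smul_sum, smul_comm]
  · rw [if_neg h, mul_smul_comm, smul_mul_assoc, smul_comm, e_mul_offDiag η h]

/-- The signs `E` and the group `W` are compatible: `W` contains the reflections `s^η` with
`η ∈ E`, and conjugation by `W` preserves this set of reflections. -/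
structure SignCompatible (W : Subgroup (SignedPerm n)) (E : Finset ℤˣ) : Prop where
  mem : ∀ η ∈ E, ∀ i j, sEta η i j ∈ W
  mul_mem : ∀ g ∈ W, ∀ η ∈ E, ∀ i j, η * (usgn g i * usgn g j) ∈ E

/-- Multiplication by a fixed sign is an involution of $E$. -/
theorem SignCompatible.sum_mul {E : Finset ℤˣ} (hE : SignCompatible W E) {g : SignedPerm n}
    (hg : g ∈ W) (i j : Fin n) {A : Type*} [AddCommMonoid A] (F : ℤˣ → A) :
    ∑ η ∈ E, F (η * (usgn g i * usgn g j)) = ∑ η ∈ E, F η := by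
  have h : ∀ η : ℤˣ, η * (usgn g i * usgn g j) * (usgn g i * usgn g j) = η := fun η => by
    rw [mul_assoc, Int.units_mul_self, mul_one]
  exact Finset.sum_nbij' (· * (usgn g i * usgn g j)) (· * (usgn g i * usgn g j))
    (fun η hη => hE.mul_mem g hg η hη i j) (fun η hη => hE.mul_mem g hg η hη i j)
    (fun η _ => h η) (fun η _ => h η) (fun η _ => rfl)

/-- The brackets for a single $\eta$ need not be equivariant, because conjugation can exchange $s$
and $\bar s$; the sum over a compatible set of signs is. -/
theorem w_mul_sum_brEta {E : Finset ℤˣ} (hE : SignCompatible W E) (g : W) (i j : Fin n) :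
    K.w g * ∑ η ∈ E, brEta W η i j =
      (sgn (g : SignedPerm n) i * sgn (g : SignedPerm n) j) •
        ((∑ η ∈ E, brEta W η (perm (g : SignedPerm n) i) (perm (g : SignedPerm n) j)) *
          K.w g) := by
  rw [sgn_eq, sgn_eq]
  have hinj := (perm (g : SignedPerm n)).injective
  by_cases h : i = j
  · subst h
    simp only [brEta, if_true, signC_mul_self, one_smul]
    rw [← Finset.smul_sum, ← Finset.smul_sum, mul_smul_comm, smul_mul_assoc]
    congr 1
    -- The shift of $\eta$ caused by $g$ depends on $k$, so the sum over $\eta$ must be the inner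
    -- one.
    rw [Finset.sum_comm, Finset.sum_comm (s := E), Finset.mul_sum, Finset.sum_mul]
    refine Finset.sum_equiv (perm (g : SignedPerm n)) (fun k => by simp) (fun k hk => ?_)
    have hk' := Finset.ne_of_mem_erase hk
    rw [← hE.sum_mul g.2 k i fun η => onDiag W η (perm (g : SignedPerm n) k) _, Finset.mul_sum, Finset.sum_mul]
    exact Finset.sum_congr rfl fun η hη => w_mul_onDiag hk' (hE.mem _ hη _ _) g
      (hE.mem _ (hE.mul_mem _ g.2 _ hη _ _) _ _)
  · have h' : perm (g : SignedPerm n) i ≠ perm (g : SignedPerm n) j := fun e => h (hinj e)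
    simp only [brEta, if_neg h, if_neg h']
    rw [← hE.sum_mul g.2 i j fun η => signC η • offDiag W η (perm (g : SignedPerm n) i) _,
      Finset.mul_sum, Finset.sum_mul, Finset.smul_sum]
    refine Finset.sum_congr rfl fun η hη => ?_
    rw [mul_smul_comm, w_mul_offDiag h (hE.mem _ hη _ _) g
      (hE.mem _ (hE.mul_mem _ g.2 _ hη _ _) _ _), smul_mul_assoc, smul_smul, ← signC_mul,
      ← signC_mul,
      mul_left_comm (usgn (g : SignedPerm n) i * usgn (g : SignedPerm n) j) η, Int.units_mul_self, mul_one]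

/-! ### The Jacobi identity for the reflection brackets -/

section Jacobi

variable {M : Type*} [AddCommGroup M] [Module ℂ M] [Module (K W) M] [IsScalarTower ℂ (K W) M]
variable {Y : Fin n → Module.End ℂ (PolyTensor n M)}

namespace KEquivariant

theorem cc_mul (hY : KEquivariant Y (kRep (W := W) M)) (η : ℤˣ) (i j k : Fin n) :
    kRep M (cc W η i j) * Y k = Y k * kRep M (cc W η i j) := by
  rw [cc, map_add, map_one, map_smul, map_mul, add_mul, mul_add, one_mul, mul_one, smul_mul_assoc,
    mul_smul_comm, mul_assoc, hY.c_mul, ← mul_assoc, hY.c_mul, mul_assoc]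

theorem ee_mul (hY : KEquivariant Y (kRep (W := W) M)) (η : ℤˣ) {i j k : Fin n} (hi : i ≠ k)
    (hj : j ≠ k) : kRep M (ee W η i j) * Y k = Y k * kRep M (ee W η i j) := by
  rw [ee, map_add, map_one, map_smul, map_mul, add_mul, mul_add, one_mul, mul_one, smul_mul_assoc,
    mul_smul_comm, mul_assoc, hY.e_mul, if_neg hj, one_smul, ← mul_assoc, hY.e_mul, if_neg hi,
    one_smul, mul_assoc]

/-- $Y_j$ anticommutes with $e_j$ and commutes with $e_i$, so passing it reverses $e_ie_j$ into
$e_je_i$. This turns diagonal bracket terms into off-diagonal ones. -/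
theorem ee_mul_right (hY : KEquivariant Y (kRep (W := W) M)) (η : ℤˣ) {i j : Fin n}
    (hij : i ≠ j) : kRep M (ee W η i j) * Y j = Y j * kRep M (ee W η j i) := by
  have h : ee W η j i = 1 + (-1 : ℂ) • signC η • (e i * e j) := by
    rw [ee, e_mul_e hij.symm, neg_one_smul, smul_neg]
  rw [h, ee, map_add, map_add, map_one, map_smul, map_smul, map_smul, map_mul, add_mul, mul_add,
    one_mul, mul_one, smul_mul_assoc, mul_smul_comm, mul_smul_comm, mul_assoc, hY.e_mul,
    if_pos rfl, mul_smul_comm, ← mul_assoc, hY.e_mul, if_neg hij, one_smul, mul_assoc, smul_comm]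

theorem wE_mul (hY : KEquivariant Y (kRep (W := W) M)) (g : SignedPerm n) (i : Fin n) :
    kRep M (wE W g) * Y i = signC (usgn g i) • (Y (perm g i) * kRep M (wE W g)) := by
  by_cases h : g ∈ W
  · rw [wE, dif_pos h]
    exact hY.w_mul ⟨g, h⟩ i
  · rw [wE, dif_neg h, map_zero, zero_mul, mul_zero, smul_zero]

theorem offDiag_mul_of_ne (hY : KEquivariant Y (kRep (W := W) M)) (η : ℤˣ) {i j k : Fin n}
    (hi : i ≠ k) (hj : j ≠ k) :
    kRep M (offDiag W η i j) * Y k = Y k * kRep M (offDiag W η i j) := by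
  rw [offDiag, map_mul, map_mul, mul_assoc, hY.wE_mul, usgn_sEta_of_ne η hi.symm hj.symm,
    perm_sEta, Equiv.swap_apply_of_ne_of_ne hi.symm hj.symm, signC_one, one_smul, mul_assoc,
    ← mul_assoc _ (Y k), hY.ee_mul η hj hi, ← mul_assoc, ← mul_assoc, hY.cc_mul]
  simp only [mul_assoc]

theorem onDiag_mul_of_ne (hY : KEquivariant Y (kRep (W := W) M)) (η : ℤˣ) {i j k : Fin n}
    (hi : i ≠ k) (hj : j ≠ k) :
    kRep M (onDiag W η i j) * Y k = Y k * kRep M (onDiag W η i j) := by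
  rw [onDiag, map_mul, map_mul, mul_assoc, hY.wE_mul, usgn_sEta_of_ne η hi.symm hj.symm,
    perm_sEta, Equiv.swap_apply_of_ne_of_ne hi.symm hj.symm, signC_one, one_smul, mul_assoc,
    ← mul_assoc _ (Y k), hY.ee_mul η hi hj, ← mul_assoc, ← mul_assoc, hY.cc_mul]
  simp only [mul_assoc]

theorem onDiag_mul (hY : KEquivariant Y (kRep (W := W) M)) (η : ℤˣ) {i j : Fin n}
    (hij : j ≠ i) :
    kRep M (onDiag W η j i) * Y j = Y i * kRep M (signC η • offDiag W η j i) := by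
  rw [onDiag, offDiag, map_smul, map_mul, map_mul, map_mul, map_mul, mul_assoc, hY.wE_mul,
    usgn_sEta_left η hij, perm_sEta, Equiv.swap_apply_left, mul_smul_comm, mul_smul_comm,
    mul_assoc, ← mul_assoc _ (Y i), hY.ee_mul_right η hij, ← mul_assoc, ← mul_assoc, hY.cc_mul]
  simp only [mul_assoc]

theorem mul_onDiag (hY : KEquivariant Y (kRep (W := W) M)) (η : ℤˣ) {i j : Fin n}
    (hij : j ≠ i) :
    Y j * kRep M (onDiag W η j i) = kRep M (signC η • offDiag W η j i) * Y i := by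
  rw [onDiag, offDiag, map_smul, map_mul, map_mul, map_mul, map_mul, smul_mul_assoc,
    mul_assoc _ _ (Y i), hY.wE_mul, usgn_sEta_right η hij, perm_sEta, Equiv.swap_apply_right,
    mul_smul_comm, smul_smul, signC_mul_self, one_smul, mul_assoc _ _ (Y j * _),
    ← mul_assoc _ (Y j), hY.ee_mul_right η hij.symm, ← mul_assoc, ← mul_assoc,
    ← hY.cc_mul]
  simp only [mul_assoc]

/-- On each side the summand $k=j$ of $b_{ii}$ cancels the term with $b_{ji}$; the remaining
summands do not involve $j$ and commute with $Y_j$. -/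
theorem brEta_self (hY : KEquivariant Y (kRep (W := W) M)) (η : ℤˣ) {i j : Fin n} (hij : i ≠ j) :
    kRep M (brEta W η i i) * Y j + Y i * kRep M (brEta W η j i) =
      kRep M (brEta W η j i) * Y i + Y j * kRep M (brEta W η i i) := by
  have hj : j ∈ Finset.univ.erase i := Finset.mem_erase.2 ⟨hij.symm, Finset.mem_univ j⟩
  rw [brEta, brEta, if_pos rfl, if_neg hij.symm, ← Finset.add_sum_erase _ _ hj]
  set S := ∑ k ∈ (Finset.univ.erase i).erase j, onDiag W η k i with hS
  have h : kRep M S * Y j = Y j * kRep M S := by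
    rw [hS, map_sum, Finset.sum_mul, Finset.mul_sum]
    exact Finset.sum_congr rfl fun k hk => hY.onDiag_mul_of_ne η (Finset.ne_of_mem_erase hk) hij
  rw [← hY.onDiag_mul η hij.symm, ← hY.mul_onDiag η hij.symm, map_smul, map_add, smul_mul_assoc,
    mul_smul_comm, add_mul, mul_add, h]
  module

theorem brEta_jacobi (hY : KEquivariant Y (kRep (W := W) M)) (η : ℤˣ) (i j k : Fin n)
    (hij : i ≠ j) : kRep M (brEta W η i k) * Y j + Y i * kRep M (brEta W η j k) =
      kRep M (brEta W η j k) * Y i + Y j * kRep M (brEta W η i k) := by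
  rcases eq_or_ne i k with rfl | hi
  · exact hY.brEta_self η hij
  rcases eq_or_ne j k with rfl | hj
  · exact (hY.brEta_self η hij.symm).symm
  · rw [brEta, brEta, if_neg hi, if_neg hj, map_smul, map_smul, smul_mul_assoc, mul_smul_comm,
      smul_mul_assoc, mul_smul_comm, hY.offDiag_mul_of_ne η hij hj.symm,
      hY.offDiag_mul_of_ne η hij.symm hi.symm, add_comm]

end KEquivariant

/-! ### Dunkl operators for reflections -/

variable (M) in
theorem kRep_wE {g : SignedPerm n} (hg : g ∈ W) : kRep M (wE W g) = actTensor W M g (wE W g) := by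
  rw [wE, dif_pos hg, kRep_w]

variable (M) in
theorem kRep_ee_mul_wE (η : ℤˣ) (i j : Fin n) {g : SignedPerm n} (hg : g ∈ W) :
    kRep M (ee W η i j * wE W g) = actTensor W M g (ee W η i j * wE W g) := by
  have h : kRep M (ee W η i j) = actTensor W M 1 (ee W η i j) := by
    rw [ee, map_add, map_one, map_smul, map_mul, kRep_e, kRep_e, actTensor_mul, mul_one,
      ← actTensor_smul, ← actTensor_one (W := W)]
    refine TensorProduct.ext' fun f m => ?_
    simp [add_smul, TensorProduct.tmul_add]
  rw [map_mul, h, kRep_wE M hg, actTensor_mul, one_mul]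

-- The $e$'s are invisible on polynomials, whereas $c_kc_i$ contributes $\tau_k\tau_i$, so the
-- polynomial part is $s^{-\eta}$ instead of $s^\eta$.
variable (M) in
theorem kRep_c_mul_c_mul_ee_mul_wE (η : ℤˣ) (k i : Fin n) (h : sEta η k i ∈ W) :
    kRep M (c k * c i * (ee W η k i * wE W (sEta η k i))) =
      actTensor W M (sEta (-η) k i) (c k * c i * (ee W η k i * wE W (sEta η k i))) := by
  rw [map_mul, map_mul, kRep_c, kRep_c, kRep_ee_mul_wE M η k i h, actTensor_mul, actTensor_mul,
    mul_assoc (tauRefl k), tauRefl_mul_tauRefl_mul_sEta]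

/-- The divided difference at `s^η`, tensored with the action of `a`. -/
noncomputable def sTensor (W : Subgroup (SignedPerm n)) (M : Type*) [AddCommGroup M] [Module ℂ M]
    [Module (K W) M] [IsScalarTower ℂ (K W) M] (η : ℤˣ) (k i : Fin n) (a : K W) :
    Module.End ℂ (PolyTensor n M) :=
  -- For $k=i$ and $\eta=1$ the divisor would vanish; the Dunkl sums run over $k\ne i$ only, so this
  -- value never enters.
  if h : k = i then 0
  else divTensor W M (sEta η k i) (X_sub_smul_X_ne_zero (signC η) h) (dvd_sub_act_sEta η h) a

theorem sTensor_tmul (η : ℤˣ) {k i : Fin n} (h : k ≠ i) (a : K W) (f : MvPolynomial (Fin n) ℂ)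
    (m : M) : sTensor W M η k i a (f ⊗ₜ m) =
      exactDiv (f - act (sEta η k i) f) (MvPolynomial.X i - signC η • MvPolynomial.X k) ⊗ₜ
        (a • m) := by
  rw [sTensor, dif_neg h, divTensor_tmul]

theorem sTensor_one_tmul (η : ℤˣ) (k i : Fin n) (a : K W) (m : M) :
    sTensor W M η k i a (1 ⊗ₜ m) = 0 := by
  rw [sTensor]
  split_ifs
  · rfl
  · exact divTensor_one_tmul _ _ _ _ _

theorem sTensor_mul_mulX (η : ℤˣ) {k i : Fin n} (h : k ≠ i) (a : K W) (j : Fin n) :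
    sTensor W M η k i a * mulX M j = mulX M j * sTensor W M η k i a +
      (if i = j then (1 : ℂ) else if k = j then -signC η else 0) •
        actTensor W M (sEta η k i) a := by
  rw [sTensor, dif_neg h]
  exact divTensor_mul_mulX _ _ _ a (X_sub_act_sEta_X η h j)

/-- The part of the Dunkl operator at `i` coming from the reflection `s^η` in `k` and `i`. -/
noncomputable def reflOp (W : Subgroup (SignedPerm n)) (M : Type*) [AddCommGroup M] [Module ℂ M]
    [Module (K W) M] [IsScalarTower ℂ (K W) M] (η : ℤˣ) (k i : Fin n) :
    Module.End ℂ (PolyTensor n M) :=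
  sTensor W M η k i (ee W η k i * wE W (sEta η k i)) +
    signC η • sTensor W M (-η) k i (c k * c i * (ee W η k i * wE W (sEta η k i)))

/-- Write $A=(1+\eta e_ke_i)s^\eta$. For $j=i$ the two divided differences contribute $A+\eta
c_kc_iA$. For $j=k$ they contribute $-\eta A+c_kc_iA=-\eta(1+\eta c_ic_k)A$, by anticommutation. -/
theorem reflOp_mul_mulX {η : ℤˣ} {k i : Fin n} (h : k ≠ i) (hW : sEta η k i ∈ W) (j : Fin n) :
    reflOp W M η k i * mulX M j = mulX M j * reflOp W M η k i +
      (if i = j then kRep M (onDiag W η k i)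
        else if k = j then kRep M ((-signC η) • offDiag W η i k) else 0) := by
  rw [reflOp, add_mul, smul_mul_assoc, sTensor_mul_mulX η h, sTensor_mul_mulX (-η) h,
    ← kRep_ee_mul_wE M η k i hW, ← kRep_c_mul_c_mul_ee_mul_wE M η k i hW, mul_add, mul_smul_comm,
    smul_add, add_add_add_comm]
  congr 1
  by_cases hi : i = j
  · simp only [if_pos hi]
    rw [onDiag, cc, mul_assoc (1 + _), add_mul, one_mul, map_add, smul_mul_assoc, map_smul, one_smul,
      one_smul]
  by_cases hk : k = j
  · simp only [if_neg hi, if_pos hk]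
    rw [offDiag, cc_swap η h.symm, mul_assoc (1 + _), add_mul, one_mul, smul_mul_assoc, sEta_comm η i k,
      map_smul, map_add, map_smul, smul_add, signC_neg, neg_neg, smul_smul, smul_smul, neg_mul_neg]
  · simp only [if_neg hi, if_neg hk, zero_smul, smul_zero, add_zero]

/-- The Dunkl operator at `i` for the reflections `s^η`, with `u = 1`. -/
noncomputable def dunklEta (W : Subgroup (SignedPerm n)) (M : Type*) [AddCommGroup M] [Module ℂ M]
    [Module (K W) M] [IsScalarTower ℂ (K W) M] (η : ℤˣ) (i : Fin n) :
    Module.End ℂ (PolyTensor n M) :=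
  (-1 : ℂ) • ∑ k ∈ Finset.univ.erase i, reflOp W M η k i

theorem dunklEta_one_tmul (η : ℤˣ) (i : Fin n) (m : M) : dunklEta W M η i (1 ⊗ₜ m) = 0 := by
  rw [dunklEta, LinearMap.smul_apply, LinearMap.sum_apply, Finset.sum_eq_zero, smul_zero]
  intro k _
  rw [reflOp, LinearMap.add_apply, LinearMap.smul_apply, sTensor_one_tmul, sTensor_one_tmul,
    smul_zero, add_zero]

theorem dunklEta_mul_mulX {η : ℤˣ} (hW : ∀ k i, sEta η k i ∈ W) (i j : Fin n) :
    dunklEta W M η i * mulX M j = mulX M j * dunklEta W M η i + kRep M (brEta W η i j) := by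
  rw [dunklEta, smul_mul_assoc, mul_smul_comm, Finset.sum_mul, Finset.mul_sum,
    Finset.sum_congr rfl fun k hk =>
      reflOp_mul_mulX (M := M) (Finset.ne_of_mem_erase hk) (hW k i) j,
    Finset.sum_add_distrib, smul_add]
  congr 1
  by_cases hi : i = j
  · simp only [brEta, if_pos hi, map_smul, map_sum]
  · have hj : j ∈ Finset.univ.erase i := Finset.mem_erase.2 ⟨Ne.symm hi, Finset.mem_univ j⟩
    simp only [brEta, if_neg hi]
    -- Only the reflection with $k=j$ fails to commute with $x_j$; the overall sign $-1$ turns its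
    -- coefficient $-\eta$ into $\eta$.
    rw [Finset.sum_ite_eq', if_pos hj, ← map_smul, smul_smul, neg_one_mul, neg_neg]

theorem dunklDatum_eta {E : Finset ℤˣ} (hE : SignCompatible W E) :
    DunklDatum (fun i j => ∑ η ∈ E, brEta W η i j) (fun i => ∑ η ∈ E, dunklEta W M η i) where
  one_tmul i m := by
    rw [LinearMap.sum_apply]
    exact Finset.sum_eq_zero fun η _ => dunklEta_one_tmul η i m
  mul_mulX i j := by
    rw [Finset.sum_mul, Finset.mul_sum, map_sum, ← Finset.sum_add_distrib]
    exact Finset.sum_congr rfl fun η hη => dunklEta_mul_mulX (hE.mem η hη) i j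
  w_mul g i j := w_mul_sum_brEta hE g i j
  c_mul k i j := by
    rw [Finset.mul_sum, Finset.sum_mul, Finset.smul_sum]
    exact Finset.sum_congr rfl fun η _ => c_mul_brEta η k i j
  e_mul k i j := by
    rw [Finset.mul_sum, Finset.sum_mul, Finset.smul_sum]
    exact Finset.sum_congr rfl fun η _ => e_mul_brEta η k i j
  jacobi Y hY i j k hij := by
    simp only [map_sum, Finset.sum_mul, Finset.mul_sum]
    rw [← Finset.sum_add_distrib, ← Finset.sum_add_distrib]
    exact Finset.sum_congr rfl fun η _ => hY.brEta_jacobi η i j k hij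

end Jacobi

end Reflections

/-! ### The three types -/

theorem sRefl_mem_weylA (i j : Fin n) : sRefl i j ∈ weylA n := ⟨_, rfl⟩

/-- Permutations carry no signs, so $s$ is never conjugated to $\bar s$ and $E=\{1\}$ suffices. -/
theorem signCompatible_weylA : SignCompatible (weylA n) {1} where
  mem η hη i j := by
    rw [Finset.mem_singleton.1 hη, sEta_one]
    exact sRefl_mem_weylA i j
  mul_mem := by
    rintro _ ⟨σ, rfl⟩ η hη i j
    rw [Finset.mem_singleton.1 hη]
    simp [usgn]

theorem signCompatible_weylB : SignCompatible (weylB n) Finset.univ where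
  mem _ _ _ _ := trivial
  mul_mem _ _ _ _ _ _ := Finset.mem_univ _

theorem signCompatible_weylD : SignCompatible (weylD n) Finset.univ where
  mem η _ i j := by
    rcases Int.units_eq_one_or η with rfl | rfl
    · rw [sEta_one]; exact sRefl_mem_weylD i j
    · rw [sEta_neg_one]; exact sBar_mem_weylD i j
  mul_mem _ _ _ _ _ _ := Finset.mem_univ _

theorem sum_units_int {A : Type*} [AddCommMonoid A] (F : ℤˣ → A) :
    ∑ η : ℤˣ, F η = F 1 + F (-1) := by
  rw [UnitsInt.univ, Finset.sum_pair (by decide)]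

section Types

variable {W : Subgroup (SignedPerm n)}
variable {M : Type*} [AddCommGroup M] [Module ℂ M] [Module (K W) M] [IsScalarTower ℂ (K W) M]

theorem tauTensor_tmul (i : Fin n) (a : K W) (f : MvPolynomial (Fin n) ℂ) (m : M) :
    tauTensor W M i a (f ⊗ₜ m) =
      exactDiv (f - act (tauRefl i) f) (2 * MvPolynomial.X i) ⊗ₜ (a • m) := rfl

theorem dunklEta_one_apply (i : Fin n) (f : MvPolynomial (Fin n) ℂ) (m : M) :
    dunklEta W M 1 i (f ⊗ₜ m) = -∑ k ∈ Finset.univ.erase i,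
      (exactDiv (f - act (sRefl k i) f) (MvPolynomial.X i - MvPolynomial.X k) ⊗ₜ[ℂ]
          (((1 + K.e k * K.e i) * K.wE W (sRefl k i) : K W) • m)
        + exactDiv (f - act (sBar k i) f) (MvPolynomial.X i + MvPolynomial.X k) ⊗ₜ[ℂ]
          ((K.c k * K.c i * (1 + K.e k * K.e i) * K.wE W (sRefl k i) : K W) • m)) := by
  rw [dunklEta, LinearMap.smul_apply, LinearMap.sum_apply, neg_one_smul]
  congr 1
  refine Finset.sum_congr rfl fun k hk => ?_
  have hk' := Finset.ne_of_mem_erase hk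
  rw [reflOp, LinearMap.add_apply, LinearMap.smul_apply, sTensor_tmul _ hk', sTensor_tmul _ hk',
    sEta_one, sEta_neg_one, signC_neg, signC_one, one_smul, one_smul, neg_one_smul, sub_neg_eq_add,
    K.ee, signC_one, one_smul, mul_assoc (K.c k * K.c i)]

theorem dunklEta_neg_one_apply (i : Fin n) (f : MvPolynomial (Fin n) ℂ) (m : M) :
    dunklEta W M (-1) i (f ⊗ₜ m) = -∑ k ∈ Finset.univ.erase i,
      (exactDiv (f - act (sBar k i) f) (MvPolynomial.X i + MvPolynomial.X k) ⊗ₜ[ℂ]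
          (((1 - K.e k * K.e i) * K.wE W (sBar k i) : K W) • m)
        - exactDiv (f - act (sRefl k i) f) (MvPolynomial.X i - MvPolynomial.X k) ⊗ₜ[ℂ]
          ((K.c k * K.c i * (1 - K.e k * K.e i) * K.wE W (sBar k i) : K W) • m)) := by
  rw [dunklEta, LinearMap.smul_apply, LinearMap.sum_apply, neg_one_smul]
  congr 1
  refine Finset.sum_congr rfl fun k hk => ?_
  have hk' := Finset.ne_of_mem_erase hk
  rw [reflOp, LinearMap.add_apply, LinearMap.smul_apply, sTensor_tmul _ hk', sTensor_tmul _ hk',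
    neg_neg, sEta_one, sEta_neg_one, signC_neg, signC_one, one_smul, neg_one_smul, neg_one_smul,
    sub_neg_eq_add, K.ee, signC_neg, signC_one, neg_one_smul, ← sub_eq_add_neg, ← sub_eq_add_neg,
    mul_assoc (K.c k * K.c i)]

theorem brEta_one (i j : Fin n) : brEta W 1 i j =
    if i = j then -∑ k ∈ Finset.univ.erase i,
      (1 + K.c k * K.c i) * (1 + K.e k * K.e i) * K.wE W (sRefl k i)
    else (1 + K.c i * K.c j) * (1 + K.e j * K.e i) * K.wE W (sRefl i j) := by
  simp only [brEta, K.onDiag, K.offDiag, K.cc, K.ee, sEta_one, signC_one, one_smul, neg_one_smul]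

theorem brEta_neg_one (i j : Fin n) : brEta W (-1) i j =
    if i = j then -∑ k ∈ Finset.univ.erase i,
      (1 - K.c k * K.c i) * (1 - K.e k * K.e i) * K.wE W (sBar k i)
    else -((1 - K.c i * K.c j) * (1 - K.e j * K.e i) * K.wE W (sBar i j)) := by
  simp only [brEta, K.onDiag, K.offDiag, K.cc, K.ee, sEta_neg_one, signC_one, signC_neg,
    neg_one_smul, ← sub_eq_add_neg]

/-- Needed in type $A$, where $\bar s_{ki}$ is not in the group but still acts on polynomials,
through $c_kc_is_{ki}$. -/
theorem act_sBar (k i : Fin n) (f : MvPolynomial (Fin n) ℂ) :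
    act (sBar k i) f = act (tauRefl k) (act (tauRefl i) (act (sRefl k i) f)) := by
  rw [sBar, act_mul, act_mul]
  rfl

end Types

theorem wE_sA (k i : Fin n) : K.wE (weylA n) (sRefl k i) = K.w (sA k i) := K.wE_coe (sA k i)

theorem wE_sB (k i : Fin n) : K.wE (weylB n) (sRefl k i) = K.w (sB k i) := K.wE_coe (sB k i)

theorem wE_sbB (k i : Fin n) : K.wE (weylB n) (sBar k i) = K.w (sbB k i) := K.wE_coe (sbB k i)

theorem wE_tauB (i : Fin n) : K.wE (weylB n) (tauRefl i) = K.w (tauB i) := K.wE_coe (tauB i)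

theorem wE_sD (k i : Fin n) : K.wE (weylD n) (sRefl k i) = K.w (sD k i) := K.wE_coe (sD k i)

theorem wE_sbD (k i : Fin n) : K.wE (weylD n) (sBar k i) = K.w (sbD k i) := K.wE_coe (sbD k i)

theorem brA_eq (t u : ℂ) : brA t u = fun i j : Fin n =>
    t • brDiag (fun i => K.c i * K.e i) i j + u • ∑ η ∈ {1}, brEta (weylA n) η i j := by
  funext i j
  rw [Finset.sum_singleton, brEta_one, brA, brDiag]
  simp only [wE_sA]
  split_ifs
  · module
  · module

theorem brB_eq (t u v : ℂ) : brB t u v = fun i j : Fin n =>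
    t • brDiag (fun i => K.c i * K.e i) i j + u • ∑ η, brEta (weylB n) η i j
      + (-v) • brDiag (fun i => K.wE (weylB n) (tauRefl i)) i j := by
  funext i j
  rw [sum_units_int, brEta_one, brEta_neg_one, brB, brDiag, brDiag]
  simp only [wE_sB, wE_sbB, wE_tauB]
  split_ifs
  · module
  · module

theorem brD_eq (t u : ℂ) : brD t u = fun i j : Fin n =>
    t • brDiag (fun i => K.c i * K.e i) i j + u • ∑ η, brEta (weylD n) η i j := by
  funext i j
  rw [sum_units_int, brEta_one, brEta_neg_one, brD, brDiag]
  simp only [wE_sD, wE_sbD]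
  split_ifs
  · module
  · module

end DunklDaHa

/-! ### Assembly of the three types -/

open MvPolynomial DunklDaHa in
theorem mainTheorem8 (n : ℕ) (t u v : ℂ) :
    (∀ (M : Type*) [AddCommGroup M] [Module ℂ M] [Module (K (weylA n)) M]
        [IsScalarTower ℂ (K (weylA n)) M],
      DunklRealization (brA t u) M fun i f m =>
        t • (exactDiv (f - act (tauRefl i) f) (2 * X i)
            ⊗ₜ[ℂ] ((K.c i * K.e i : K (weylA n)) • m))
        - u • ∑ k ∈ Finset.univ.erase i,
            (exactDiv (f - act (sRefl k i) f) (X i - X k)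
                ⊗ₜ[ℂ] (((1 + K.e k * K.e i) * K.w (sA k i) : K (weylA n)) • m)
              + exactDiv (f - act (tauRefl k) (act (tauRefl i) (act (sRefl k i) f))) (X i + X k)
                ⊗ₜ[ℂ] ((K.c k * K.c i * (1 + K.e k * K.e i) * K.w (sA k i) : K (weylA n)) • m))) ∧
    (∀ (M : Type*) [AddCommGroup M] [Module ℂ M] [Module (K (weylB n)) M]
        [IsScalarTower ℂ (K (weylB n)) M],
      DunklRealization (brB t u v) M fun i f m =>
        t • (exactDiv (f - act (tauRefl i) f) (2 * X i)
            ⊗ₜ[ℂ] ((K.c i * K.e i : K (weylB n)) • m))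
        - u • ∑ k ∈ Finset.univ.erase i,
            (exactDiv (f - act (sRefl k i) f) (X i - X k)
                ⊗ₜ[ℂ] (((1 + K.e k * K.e i) * K.w (sB k i) : K (weylB n)) • m)
              + exactDiv (f - act (sBar k i) f) (X i + X k)
                ⊗ₜ[ℂ] ((K.c k * K.c i * (1 + K.e k * K.e i) * K.w (sB k i) : K (weylB n)) • m))
        - u • ∑ k ∈ Finset.univ.erase i,
            (exactDiv (f - act (sBar k i) f) (X i + X k)
                ⊗ₜ[ℂ] (((1 - K.e k * K.e i) * K.w (sbB k i) : K (weylB n)) • m)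
              - exactDiv (f - act (sRefl k i) f) (X i - X k)
                ⊗ₜ[ℂ] ((K.c k * K.c i * (1 - K.e k * K.e i) * K.w (sbB k i) : K (weylB n)) • m))
        - v • (exactDiv (f - act (tauRefl i) f) (2 * X i)
            ⊗ₜ[ℂ] ((K.w (tauB i) : K (weylB n)) • m))) ∧
    (∀ (M : Type*) [AddCommGroup M] [Module ℂ M] [Module (K (weylD n)) M]
        [IsScalarTower ℂ (K (weylD n)) M],
      DunklRealization (brD t u) M fun i f m =>
        t • (exactDiv (f - act (tauRefl i) f) (2 * X i)
            ⊗ₜ[ℂ] ((K.c i * K.e i : K (weylD n)) • m))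
        - u • ∑ k ∈ Finset.univ.erase i,
            (exactDiv (f - act (sRefl k i) f) (X i - X k)
                ⊗ₜ[ℂ] (((1 + K.e k * K.e i) * K.w (sD k i) : K (weylD n)) • m)
              + exactDiv (f - act (sBar k i) f) (X i + X k)
                ⊗ₜ[ℂ] ((K.c k * K.c i * (1 + K.e k * K.e i) * K.w (sD k i) : K (weylD n)) • m))
        - u • ∑ k ∈ Finset.univ.erase i,
            (exactDiv (f - act (sBar k i) f) (X i + X k)
                ⊗ₜ[ℂ] (((1 - K.e k * K.e i) * K.w (sbD k i) : K (weylD n)) • m)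
              - exactDiv (f - act (sRefl k i) f) (X i - X k)
                ⊗ₜ[ℂ] ((K.c k * K.c i * (1 - K.e k * K.e i) * K.w (sbD k i) : K (weylD n)) • m))) := by
  refine ⟨fun M _ _ _ _ => ?_, fun M _ _ _ _ => ?_, fun M _ _ _ _ => ?_⟩
  · have h := (((dunklDatum_c_mul_e (W := weylA n) (M := M)).smul t).add
      ((dunklDatum_eta signCompatible_weylA).smul u)).dunklRealization
    rw [← brA_eq] at h
    -- Only the formula for $y_i$ on a pure tensor remains to be compared; it differs from the
    -- assembled datum by regrouping scalars and sums.
    convert h using 4 with i f m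
    simp only [Finset.sum_singleton, LinearMap.add_apply, LinearMap.smul_apply, tauTensor_tmul,
      dunklEta_one_apply, wE_sA, act_sBar]
    module
  · have h := ((((dunklDatum_c_mul_e (W := weylB n) (M := M)).smul t).add
      ((dunklDatum_eta signCompatible_weylB).smul u)).add
        ((dunklDatum_tau (W := weylB n) fun _ => trivial).smul (-v))).dunklRealization
    rw [← brB_eq] at h
    convert h using 4 with i f m
    simp only [sum_units_int, LinearMap.add_apply, LinearMap.smul_apply, tauTensor_tmul,
      dunklEta_one_apply, dunklEta_neg_one_apply, wE_sB, wE_sbB, wE_tauB]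
    module
  · have h := (((dunklDatum_c_mul_e (W := weylD n) (M := M)).smul t).add
      ((dunklDatum_eta signCompatible_weylD).smul u)).dunklRealization
    rw [← brD_eq] at h
    convert h using 4 with i f m
    simp only [sum_units_int, LinearMap.add_apply, LinearMap.smul_apply, tauTensor_tmul,
      dunklEta_one_apply, dunklEta_neg_one_apply, wE_sD, wE_sbD]
    module
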